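/- Let $d\ge 2$ be an integer. A unitary transformation on $L(\mathbb C^d)$ is a map $\rho\mapsto U\rho U^\dagger$ with $U$ a unitary $d\times d$ matrix. For unitary transformations, or probabilistic mixtures of them, $\mathcal A,\mathcal B$, let $$\tfrac12\|\mathcal A-\mathcal B\|_\diamond=\sup_{k\ge 1}\ \sup_{\Phi}\ \tfrac12\operatorname{tr}\sqrt{MM^\dagger},\qquad M=((\mathcal A-\mathcal B)\otimes \mathrm{id})(\Phi),$$ where $\Phi=|\psi\rangle\langle\psi|$ ranges over the pure states ($\psi$ a unit vector) of $\mathbb C^d\otimes\mathbb C^k$. Let $\Upsilon$ be a unitary transformation and $\{\Upsilon_x\}_{x\in X}$ a family of unitary transformations on $L(\mathbb C^d)$ with $X$ finite and non-empty. Then the minima and the maximum in $$\epsilon_\Upsilon=\min_{x\in X}\tfrac12\|\Upsilon-\Upsilon_x\|_\diamond,\qquad \epsilon=\max_{\Upsilon'}\min_{x\in X}\tfrac12\|\Upsilon'-\Upsilon_x\|_\diamond,\qquad \min_p\tfrac12\Big\|\Upsilon-\sum_{x\in X}p(x)\Upsilon_x\Big\|_\diamond$$ are attained, where $\Upsilon'$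 ranges over all unitary transformations on $L(\mathbb C^d)$ and $p$ over all probability distributions on $X$; and with $\delta_\Upsilon=1-\sqrt{1-\epsilon_\Upsilon^2}$, $$\frac2d\,\epsilon_\Upsilon^2\ \le\ \frac{4\delta_\Upsilon}{d}\Big(1-\frac{\delta_\Upsilon}{d}\Big)\ \le\ \min_p\tfrac12\Big\|\Upsilon-\sum_{x\in X}p(x)\Upsilon_x\Big\|_\diamond\ \le\ \epsilon^2 .$$ -/

import Mathlib

open scoped Matrix MatrixOrder

noncomputable section

/-- Linear mappings on the operators (complex matrices) on `ℂ^d`. -/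
abbrev SuperOp (d : ℕ) : Type :=
  Matrix (Fin d) (Fin d) ℂ →ₗ[ℂ] Matrix (Fin d) (Fin d) ℂ

/-- The trace distance function `M ↦ (1/2) tr √(M M†)`. -/
def traceDist {ι : Type*} [Fintype ι] [DecidableEq ι] (M : Matrix ι ι ℂ) : ℝ :=
  (1 / 2) * (CFC.sqrt (M * Mᴴ)).trace.re

/-- `(Ξ ⊗ id)(M)` for an operator `M` on `ℂ^d ⊗ ℂ^k`: the mapping `Ξ` is applied to each of the
`k × k` blocks `(M (i, a) (j, b))_{i, j}` of `M`. -/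
def ampliate {d : ℕ} (Ξ : SuperOp d) (k : ℕ) (M : Matrix (Fin d × Fin k) (Fin d × Fin k) ℂ) :
    Matrix (Fin d × Fin k) (Fin d × Fin k) ℂ :=
  Matrix.of fun p q => Ξ (Matrix.of fun i j => M (i, p.2) (j, q.2)) p.1 q.1

/-- The pure states `|ψ⟩⟨ψ|` on `ℂ^d ⊗ ℂ^k`, where `ψ` is a unit vector. -/
def pureStates (d k : ℕ) : Set (Matrix (Fin d × Fin k) (Fin d × Fin k) ℂ) :=
  {Φ | ∃ ψ : EuclideanSpace ℂ (Fin d × Fin k), ‖ψ‖ = 1 ∧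
    Φ = Matrix.vecMulVec (fun a => ψ a) (fun a => star (ψ a))}

/-- Half the diamond norm of the difference of two channels: the supremum of the trace distances of
their outputs over all pure inputs on `ℂ^d ⊗ ℂ^k`, with an ancilla of arbitrary dimension `k`. -/
def diamondDist {d : ℕ} (A B : SuperOp d) : ℝ :=
  sSup {t : ℝ | ∃ k : ℕ, ∃ Φ ∈ pureStates d k, t = traceDist (ampliate (A - B) k Φ)}

/-- The mapping `ρ ↦ U ρ U†`. -/
def conjBy {d : ℕ} (U : Matrix (Fin d) (Fin d) ℂ) : SuperOp d :=
  LinearMap.mulRight ℂ Uᴴ ∘ₗ LinearMap.mulLeft ℂ U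

/-- The unitary transformations `ρ ↦ U ρ U†`, with `U` unitary, of the operators on `ℂ^d`. -/
def unitaryTransformations (d : ℕ) : Set (SuperOp d) :=
  {Υ | ∃ U ∈ Matrix.unitaryGroup (Fin d) ℂ, Υ = conjBy U}

/-- The probabilistic mixture `∑ x, p x • Υ x`. -/
def mixture {d : ℕ} {X : Type*} [Fintype X] (Υ : X → SuperOp d) (p : X → ℝ) : SuperOp d :=
  ∑ x, (p x : ℂ) • Υ x

end

/-!
The diamond distances are rewritten in two ways.

*Two unitaries.* On a pure input the two outputs are pure, so their trace distance is
`√(1 - |⟨a, b⟩|²)`, and the overlap `⟨a, b⟩` is `tr (U† V ρ)` with `ρ` the reduced state of the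
input. Every density matrix is such a `ρ` (purification), hence
`diamondDist (conjBy U) (conjBy V)` is the supremum of `√(1 - |tr (U† V ρ)|²)` over the compact set
of density matrices (`diamondDist_conjBy`). This gives continuity in `U`, so that `ε` is attained.

*A unitary and a mixture.* The trace distance of a traceless Hermitian `H` is the maximum of
`Re tr (P H)` over `0 ≤ P ≤ 1`. For a fixed input `ψ` and effect `P`, the acceptance probability of
`W ψ` is a positive semidefinite form in the matrix `W` which is at most `1` on unitaries, so
`diamondDist (conjBy U) (mixture _ p)` is a supremum of the functions `∑ x, p x * advantage U Us Q x`,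
which are linear in `p`. In particular it is lower semicontinuous in `p`, and the minimum over `p`
is attained.

*Upper bound* (`exists_diamondDist_mixture_le`). The forms just described lie in the convex set
`acceptanceForms`. By separation of convex sets it is enough to find, for each such form `Q`, one
`x` whose advantage is at most `ε²`. Let `V` be a unitary at which `Q` is maximal. Comparing `V` with
`V (1 + c φ φ†)`, a unitary for suitable `c`, shows that `W ↦ Q(V, V W)` is `Q(V, V)` times
`W ↦ tr (W ρ)` for a density matrix `ρ` (`exists_densityMatrix_of_isMax`). By Cauchy–Schwarz
`Q(W, W) ≥ Q(V, V) |tr (V† W ρ)|²`. Choosing `x` with `Us x` within `ε` of `V` gives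
`Q(Us x, Us x) ≥ Q(V, V) (1 - ε²) ≥ Q(V, V) - ε² ≥ Q(U, U) - ε²`.

*Lower bound.* Testing with the maximally entangled state and the projection onto its image under
`U` yields at least `1 - max_x |tr (U† Us x)|² / d²`. The eigenvalues of the unitary `W = U† Us x`
have modulus one, and `tr (W ρ)` is a convex combination of them; this forces
`|tr W| ≤ d - 2 + 2 |tr (W ρ)|` for every density matrix `ρ` (`norm_trace_le_of_densityMatrix`), which
bounds `|tr W| / d` by `1 - 2 δ / d`.
-/

open scoped Matrix MatrixOrder

section

open scoped ComplexOrder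

/-! ### Trace distance -/

theorem Matrix.PosSemidef.re_trace_mul_nonneg {ι : Type*} [Fintype ι] [DecidableEq ι]
    {A B : Matrix ι ι ℂ} (hA : A.PosSemidef) (hB : B.PosSemidef) : 0 ≤ (A * B).trace.re := by
  obtain ⟨C, rfl⟩ := CStarAlgebra.nonneg_iff_eq_star_mul_self.mp hB.nonneg
  rw [← mul_assoc, Matrix.trace_mul_comm, ← mul_assoc]
  exact (Complex.nonneg_iff.mp (hA.mul_mul_conjTranspose_same C).trace_nonneg).1

/-- The trace distance of a traceless Hermitian matrix `H` is the maximum of `tr (P H)` over the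
effects `0 ≤ P ≤ 1`; it is attained at the projection onto the positive part of `H`. -/
theorem isGreatest_traceDist {ι : Type*} [Fintype ι] [DecidableEq ι] {H : Matrix ι ι ℂ}
    (hH : H.IsHermitian) (htr : H.trace = 0) :
    IsGreatest ((fun P : Matrix ι ι ℂ => (P * H).trace.re) '' Set.Icc 0 1) (traceDist H) := by
  have hsa : IsSelfAdjoint H := hH
  have hfin : (spectrum ℝ H).Finite := Matrix.finite_real_spectrum
  have hc (f : ℝ → ℝ) : ContinuousOn f (spectrum ℝ H) := hfin.continuousOn f
  -- `P` is the projection onto the positive part `N` of `H`.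
  set P : Matrix ι ι ℂ := cfc (fun x : ℝ => if 0 < x then 1 else 0) H with hP
  set N : Matrix ι ι ℂ := cfc (fun x : ℝ => max x 0) H with hN
  have hPH : P * H = N := by
    conv_lhs => rw [← cfc_id' ℝ H]
    rw [hP, hN, ← cfc_mul _ _ _ (hc _) (hc _)]
    congr 1; ext x
    split_ifs with h
    · simp [h.le]
    · simp [not_lt.mp h]
  have habs : CFC.sqrt (H * Hᴴ) = N + N - H := by
    have hA : (N + N - H) = cfc (fun x : ℝ => |x|) H := by
      nth_rw 1 [← cfc_id' ℝ H]
      rw [hN, ← cfc_add _ _ _ (hc _) (hc _), ← cfc_sub _ _ _ (hc _) (hc _)]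
      congr 1; ext x
      rcases le_total 0 x with h | h
      · simp [h, abs_of_nonneg h]
      · simp [h, abs_of_nonpos h]
    rw [hA, hH.eq]
    refine CFC.sqrt_unique ?_ (cfc_nonneg fun x _ => abs_nonneg x)
    rw [← cfc_mul _ _ _ (hc _) (hc _)]
    conv_rhs => rw [← cfc_id' ℝ H, ← cfc_mul _ _ _ (hc _) (hc _)]
    congr 1; ext x
    exact abs_mul_abs_self x
  have hval : traceDist H = N.trace.re := by
    rw [traceDist, habs, Matrix.trace_sub, htr, Matrix.trace_add]
    simp
    ring
  have hNpos : N.PosSemidef := Matrix.nonneg_iff_posSemidef.mp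
    (cfc_nonneg fun x _ => le_max_right x 0)
  have hNH : (N - H).PosSemidef := by
    rw [← Matrix.nonneg_iff_posSemidef]
    have : N - H = cfc (fun x : ℝ => max x 0 - x) H := by
      rw [cfc_sub _ _ _ (hc _) (hc _), cfc_id' ℝ H]
    rw [this]
    exact cfc_nonneg fun x _ => sub_nonneg.mpr (le_max_left x 0)
  constructor
  · refine ⟨P, ⟨cfc_nonneg fun x _ => by split_ifs <;> simp,
      cfc_le_one _ _ fun x _ => by split_ifs <;> simp⟩, ?_⟩
    simp only [hPH, hval]
  · rintro _ ⟨Q, ⟨h0, h1⟩, rfl⟩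
    have a1 := Matrix.PosSemidef.re_trace_mul_nonneg (Matrix.nonneg_iff_posSemidef.mp h0) hNH
    have a2 := Matrix.PosSemidef.re_trace_mul_nonneg (Matrix.le_iff.mp h1) hNpos
    rw [mul_sub, Matrix.trace_sub, Complex.sub_re] at a1
    rw [sub_mul, one_mul, Matrix.trace_sub, Complex.sub_re] at a2
    simp only
    rw [hval]
    linarith

/-- The trace distance of two pure states in terms of their overlap `c`: the difference `D` of the two
projections satisfies `D⁴ = (1 - |c|²) D²`, so that `√(D²)` is a multiple of `D²`. -/
theorem traceDist_vecMulVec_sub {ι : Type*} [Fintype ι] [DecidableEq ι] {a b : ι → ℂ}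
    (ha : star a ⬝ᵥ a = 1) (hb : star b ⬝ᵥ b = 1) :
    traceDist (Matrix.vecMulVec a (star a) - Matrix.vecMulVec b (star b))
      = √(1 - ‖star a ⬝ᵥ b‖ ^ 2) := by
  set c := star a ⬝ᵥ b with hcdef
  have hc' : star b ⬝ᵥ a = star c := by
    rw [hcdef, ← Matrix.star_dotProduct_star, star_star]
  set A := Matrix.vecMulVec a (star a) with hA
  set B := Matrix.vecMulVec b (star b) with hB
  have hAA : A * A = A := by
    rw [hA, Matrix.vecMulVec_mul_vecMulVec, ha, one_smul]
  have hBB : B * B = B := by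
    rw [hB, Matrix.vecMulVec_mul_vecMulVec, hb, one_smul]
  have hcc : c * star c = ((‖c‖ ^ 2 : ℝ) : ℂ) := by
    simpa using Complex.mul_conj' c
  have hABA : A * B * A = ((‖c‖ ^ 2 : ℝ) : ℂ) • A := by
    rw [← hcc, hA, hB, Matrix.vecMulVec_mul_vecMulVec, Matrix.vecMulVec_smul, Matrix.smul_mul,
      Matrix.vecMulVec_mul_vecMulVec, hc', Matrix.vecMulVec_smul, smul_smul, ← hcdef]
  have hBAB : B * A * B = ((‖c‖ ^ 2 : ℝ) : ℂ) • B := by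
    rw [← hcc, hA, hB, Matrix.vecMulVec_mul_vecMulVec, Matrix.vecMulVec_smul, Matrix.smul_mul,
      Matrix.vecMulVec_mul_vecMulVec, hc', Matrix.vecMulVec_smul, smul_smul, ← hcdef, mul_comm]
  have hH : (A - B)ᴴ = A - B := by
    simp [hA, hB, Matrix.conjTranspose_vecMulVec]
  have htA : A.trace = 1 := by
    rw [hA, Matrix.trace_vecMulVec, dotProduct_comm, ha]
  have htB : B.trace = 1 := by
    rw [hB, Matrix.trace_vecMulVec, dotProduct_comm, hb]
  have htAB : (A * B).trace = ((‖c‖ ^ 2 : ℝ) : ℂ) := by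
    rw [← hAA, mul_assoc, Matrix.trace_mul_comm, hABA, Matrix.trace_smul, htA, smul_eq_mul, mul_one]
  have htBA : (B * A).trace = ((‖c‖ ^ 2 : ℝ) : ℂ) := by rw [Matrix.trace_mul_comm, htAB]
  have hsq : (A - B) * (A - B) = A + B - A * B - B * A := by
    rw [sub_mul, mul_sub, mul_sub, hAA, hBB]; abel
  have htr : ((A - B) * (A - B)).trace = ((2 * (1 - ‖c‖ ^ 2) : ℝ) : ℂ) := by
    rw [hsq, Matrix.trace_sub, Matrix.trace_sub, Matrix.trace_add, htA, htB, htAB, htBA]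
    push_cast; ring
  have hps : ((A - B) * (A - B)).PosSemidef := by
    have := Matrix.posSemidef_conjTranspose_mul_self (A - B)
    rwa [hH] at this
  have hnn : 0 ≤ 1 - ‖c‖ ^ 2 := by
    have := (Complex.nonneg_iff.mp hps.trace_nonneg).1
    rw [htr, Complex.ofReal_re] at this
    linarith
  rw [traceDist, hH]
  rcases hnn.eq_or_lt with h0 | hpos
  · have : (A - B) * (A - B) = 0 := by
      rw [← hps.trace_eq_zero_iff, htr, ← h0]; simp
    rw [this, ← h0]; simp
  · set s := √(1 - ‖c‖ ^ 2) with hs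
    have hs0 : 0 < s := Real.sqrt_pos.mpr hpos
    have hss : s * s = 1 - ‖c‖ ^ 2 := Real.mul_self_sqrt hnn
    have h4 : (A - B) * (A - B) * ((A - B) * (A - B))
        = ((s * s : ℝ) : ℂ) • ((A - B) * (A - B)) := by
      have e1 : A * (A * B) = A * B := by rw [← mul_assoc, hAA]
      have e2 : B * (B * A) = B * A := by rw [← mul_assoc, hBB]
      have e3 : A * B * (A * B) = ((‖c‖ ^ 2 : ℝ) : ℂ) • (A * B) := by
        rw [← mul_assoc, hABA, Matrix.smul_mul]
      have e4 : B * A * (B * A) = ((‖c‖ ^ 2 : ℝ) : ℂ) • (B * A) := by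
        rw [← mul_assoc, hBAB, Matrix.smul_mul]
      have e5 : A * B * (B * A) = ((‖c‖ ^ 2 : ℝ) : ℂ) • A := by
        rw [← hABA, mul_assoc, e2, mul_assoc]
      have e6 : B * A * (A * B) = ((‖c‖ ^ 2 : ℝ) : ℂ) • B := by
        rw [← hBAB, mul_assoc, e1, mul_assoc]
      have e7 : A * (B * A) = ((‖c‖ ^ 2 : ℝ) : ℂ) • A := by rw [← mul_assoc, hABA]
      have e8 : B * (A * B) = ((‖c‖ ^ 2 : ℝ) : ℂ) • B := by rw [← mul_assoc, hBAB]
      have e9 : A * B * B = A * B := by rw [mul_assoc, hBB]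
      have e10 : B * A * A = B * A := by rw [mul_assoc, hAA]
      rw [hsq, hss]
      simp only [mul_sub, sub_mul, mul_add, add_mul, hAA, hBB, e1, e2, e3, e4, e5, e6, e7, e8, e9,
        e10, hABA, hBAB]
      push_cast
      module
    have hroot : CFC.sqrt ((A - B) * (A - B)) = ((s⁻¹ : ℝ) : ℂ) • ((A - B) * (A - B)) := by
      refine CFC.sqrt_unique ?_ ?_
      · rw [Matrix.smul_mul, Matrix.mul_smul, h4, smul_smul, smul_smul, ← Complex.ofReal_mul,
          ← Complex.ofReal_mul]
        rw [show s⁻¹ * s⁻¹ * (s * s) = 1 by field_simp]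
        simp
      · exact (hps.smul (by exact_mod_cast (inv_pos.mpr hs0).le)).nonneg
    rw [hroot, Matrix.trace_smul, htr, smul_eq_mul, ← Complex.ofReal_mul, Complex.ofReal_re, ← hss]
    field_simp

/-! ### Overlaps of locally transformed states and the distance of two unitaries -/

/-- The density matrices on `ℂ^d`: positive semidefinite matrices of trace one. -/
def densityMatrices (d : ℕ) : Set (Matrix (Fin d) (Fin d) ℂ) :=
  {ρ | ρ.PosSemidef ∧ ρ.trace = 1}

/-- The vector `(U ⊗ 1) ψ`. -/
def actOnFirst {d k : ℕ} (U : Matrix (Fin d) (Fin d) ℂ) (ψ : Fin d × Fin k → ℂ) :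
    Fin d × Fin k → ℂ :=
  fun p => ∑ j, U p.1 j * ψ (j, p.2)

/-- The partial trace of `ψ ψ†` over the second factor. -/
def reducedState {d k : ℕ} (ψ : Fin d × Fin k → ℂ) : Matrix (Fin d) (Fin d) ℂ :=
  Matrix.of fun i j => ∑ a, ψ (i, a) * star (ψ (j, a))

/-- The overlap of `(U ⊗ 1) ψ` and `(V ⊗ 1) ψ` depends on `ψ` only through its reduced state. -/
theorem star_actOnFirst_dotProduct {d k : ℕ} (U V : Matrix (Fin d) (Fin d) ℂ)
    (ψ : Fin d × Fin k → ℂ) :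
    star (actOnFirst U ψ) ⬝ᵥ actOnFirst V ψ = (Uᴴ * V * reducedState ψ).trace := by
  set Ψ : Matrix (Fin d) (Fin k) ℂ := Matrix.of fun i a => ψ (i, a) with hΨ
  have hr : reducedState ψ = Ψ * Ψᴴ := by
    ext i j
    simp [reducedState, hΨ, Matrix.mul_apply]
  have ha (W : Matrix (Fin d) (Fin d) ℂ) (p : Fin d × Fin k) :
      actOnFirst W ψ p = (W * Ψ) p.1 p.2 := by
    simp [actOnFirst, hΨ, Matrix.mul_apply]
  have ht : (Uᴴ * V * reducedState ψ).trace = ((U * Ψ)ᴴ * (V * Ψ)).trace := by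
    rw [hr, ← Matrix.mul_assoc, Matrix.trace_mul_comm, Matrix.conjTranspose_mul]
    simp only [Matrix.mul_assoc]
  rw [ht, Matrix.trace, dotProduct, Fintype.sum_prod_type_right]
  refine Finset.sum_congr rfl fun a _ => ?_
  rw [Matrix.diag_apply, Matrix.mul_apply]
  refine Finset.sum_congr rfl fun i _ => ?_
  simp [ha]

theorem star_actOnFirst_dotProduct_self {d k : ℕ} {U : Matrix (Fin d) (Fin d) ℂ}
    (hU : U ∈ Matrix.unitaryGroup (Fin d) ℂ) (ψ : Fin d × Fin k → ℂ) :
    star (actOnFirst U ψ) ⬝ᵥ actOnFirst U ψ = star ψ ⬝ᵥ ψ := by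
  have h1 : actOnFirst 1 ψ = ψ := by
    ext p; simp [actOnFirst, Matrix.one_apply]
  have h2 := star_actOnFirst_dotProduct 1 1 ψ
  rw [h1] at h2
  rw [h2, star_actOnFirst_dotProduct, ← Matrix.star_eq_conjTranspose,
    Matrix.mem_unitaryGroup_iff'.mp hU]
  simp

theorem reducedState_mem {d k : ℕ} {ψ : Fin d × Fin k → ℂ} (hψ : star ψ ⬝ᵥ ψ = 1) :
    reducedState ψ ∈ densityMatrices d := by
  refine ⟨?_, ?_⟩
  · have hr : reducedState ψ = (Matrix.of fun (i : Fin d) (a : Fin k) => ψ (i, a)) *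
        (Matrix.of fun (i : Fin d) (a : Fin k) => ψ (i, a))ᴴ := by
      ext i j
      simp [reducedState, Matrix.mul_apply]
    rw [hr]
    exact Matrix.posSemidef_self_mul_conjTranspose _
  · have h := star_actOnFirst_dotProduct 1 1 ψ
    rw [star_actOnFirst_dotProduct_self (one_mem _), hψ] at h
    simpa using h.symm

/-- Purification: every density matrix on `ℂ^d` is the reduced state of a unit vector of
`ℂ^d ⊗ ℂ^d`. -/
theorem exists_reducedState_eq {d : ℕ} {ρ : Matrix (Fin d) (Fin d) ℂ}
    (hρ : ρ ∈ densityMatrices d) :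
    ∃ ψ : Fin d × Fin d → ℂ, star ψ ⬝ᵥ ψ = 1 ∧ reducedState ψ = ρ := by
  obtain ⟨C, hC⟩ := CStarAlgebra.nonneg_iff_eq_star_mul_self.mp hρ.1.nonneg
  have hr : reducedState (fun p : Fin d × Fin d => star (C p.2 p.1)) = ρ := by
    ext i j
    simp [reducedState, hC, Matrix.mul_apply]
  refine ⟨_, ?_, hr⟩
  rw [← star_actOnFirst_dotProduct_self (one_mem _), star_actOnFirst_dotProduct, hr]
  simpa using hρ.2

/-- Membership in `pureStates` in terms of plain functions in place of `EuclideanSpace` vectors. -/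
theorem mem_pureStates_iff {d k : ℕ} {Φ : Matrix (Fin d × Fin k) (Fin d × Fin k) ℂ} :
    Φ ∈ pureStates d k ↔
      ∃ ψ : Fin d × Fin k → ℂ, star ψ ⬝ᵥ ψ = 1 ∧ Φ = Matrix.vecMulVec ψ (star ψ) := by
  have key (ψ : EuclideanSpace ℂ (Fin d × Fin k)) : ‖ψ‖ = 1 ↔ star ψ.ofLp ⬝ᵥ ψ.ofLp = 1 := by
    have h : star ψ.ofLp ⬝ᵥ ψ.ofLp = ((‖ψ‖ ^ 2 : ℝ) : ℂ) := by
      rw [dotProduct_comm, ← EuclideanSpace.inner_eq_star_dotProduct, inner_self_eq_norm_sq_to_K]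
      simp
    rw [h]
    norm_cast
    exact (pow_eq_one_iff_of_nonneg (norm_nonneg ψ) two_ne_zero).symm
  constructor
  · rintro ⟨ψ, h1, rfl⟩
    exact ⟨ψ.ofLp, (key ψ).mp h1, rfl⟩
  · rintro ⟨ψ, h1, rfl⟩
    exact ⟨WithLp.toLp 2 ψ, (key _).mpr h1, rfl⟩

theorem ampliate_conjBy {d k : ℕ} (U : Matrix (Fin d) (Fin d) ℂ) (ψ : Fin d × Fin k → ℂ) :
    ampliate (conjBy U) k (Matrix.vecMulVec ψ (star ψ))
      = Matrix.vecMulVec (actOnFirst U ψ) (star (actOnFirst U ψ)) := by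
  ext p q
  simp only [ampliate, conjBy, LinearMap.comp_apply, LinearMap.mulLeft_apply,
    LinearMap.mulRight_apply, Matrix.of_apply, Matrix.vecMulVec_apply, Matrix.mul_apply,
    actOnFirst, Pi.star_apply, Matrix.conjTranspose_apply, star_sum, star_mul', Finset.sum_mul,
    Finset.mul_sum]
  refine Finset.sum_congr rfl fun i _ => Finset.sum_congr rfl fun j _ => ?_
  ring

theorem diamondDist_conjBy {d : ℕ} {U V : Matrix (Fin d) (Fin d) ℂ}
    (hU : U ∈ Matrix.unitaryGroup (Fin d) ℂ) (hV : V ∈ Matrix.unitaryGroup (Fin d) ℂ) :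
    diamondDist (conjBy U) (conjBy V)
      = sSup ((fun ρ => √(1 - ‖(Uᴴ * V * ρ).trace‖ ^ 2)) '' densityMatrices d) := by
  have key {k : ℕ} {ψ : Fin d × Fin k → ℂ} (hψ : star ψ ⬝ᵥ ψ = 1) :
      traceDist (ampliate (conjBy U - conjBy V) k (Matrix.vecMulVec ψ (star ψ)))
        = √(1 - ‖(Uᴴ * V * reducedState ψ).trace‖ ^ 2) := by
    have h : ampliate (conjBy U - conjBy V) k (Matrix.vecMulVec ψ (star ψ))
        = ampliate (conjBy U) k (Matrix.vecMulVec ψ (star ψ))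
          - ampliate (conjBy V) k (Matrix.vecMulVec ψ (star ψ)) := rfl
    rw [h, ampliate_conjBy, ampliate_conjBy, traceDist_vecMulVec_sub,
      star_actOnFirst_dotProduct]
    · rw [star_actOnFirst_dotProduct_self hU, hψ]
    · rw [star_actOnFirst_dotProduct_self hV, hψ]
  rw [diamondDist]
  congr 1
  ext t
  constructor
  · rintro ⟨k, Φ, hΦ, rfl⟩
    obtain ⟨ψ, hψ, rfl⟩ := mem_pureStates_iff.mp hΦ
    exact ⟨_, reducedState_mem hψ, (key hψ).symm⟩
  · rintro ⟨ρ, hρ, rfl⟩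
    obtain ⟨ψ, hψ, rfl⟩ := exists_reducedState_eq hρ
    exact ⟨d, _, mem_pureStates_iff.mpr ⟨ψ, hψ, rfl⟩, (key hψ).symm⟩

theorem sqrt_le_diamondDist {d : ℕ} {U V : Matrix (Fin d) (Fin d) ℂ}
    (hU : U ∈ Matrix.unitaryGroup (Fin d) ℂ) (hV : V ∈ Matrix.unitaryGroup (Fin d) ℂ)
    {ρ : Matrix (Fin d) (Fin d) ℂ} (hρ : ρ ∈ densityMatrices d) :
    √(1 - ‖(Uᴴ * V * ρ).trace‖ ^ 2) ≤ diamondDist (conjBy U) (conjBy V) := by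
  rw [diamondDist_conjBy hU hV]
  refine le_csSup ⟨1, ?_⟩ ⟨ρ, hρ, rfl⟩
  rintro _ ⟨σ, -, rfl⟩
  exact Real.sqrt_le_one.mpr (by linarith [sq_nonneg ‖(Uᴴ * V * σ).trace‖])

theorem isCompact_densityMatrices (d : ℕ) : IsCompact (densityMatrices d) := by
  have himg : densityMatrices d
      = reducedState '' {ψ : Fin d × Fin d → ℂ | star ψ ⬝ᵥ ψ = 1} := by
    ext ρ
    constructor
    · intro hρ
      obtain ⟨ψ, hψ, rfl⟩ := exists_reducedState_eq hρ
      exact ⟨ψ, hψ, rfl⟩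
    · rintro ⟨ψ, hψ, rfl⟩
      exact reducedState_mem hψ
  rw [himg]
  refine IsCompact.image ?_ ?_
  · refine IsCompact.of_isClosed_subset
      (isCompact_univ_pi fun _ => isCompact_closedBall (0 : ℂ) 1) ?_ ?_
    · exact isClosed_eq (by simp only [dotProduct, Pi.star_apply]; fun_prop) continuous_const
    · intro ψ hψ p _
      have h1 : ∑ q, ‖ψ q‖ ^ 2 = 1 := by
        have h2 : ((∑ q, ‖ψ q‖ ^ 2 : ℝ) : ℂ) = 1 := by
          rw [← show star ψ ⬝ᵥ ψ = 1 from hψ]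
          simp [dotProduct, Complex.conj_mul']
        exact_mod_cast h2
      have h3 : ‖ψ p‖ ^ 2 ≤ 1 := h1 ▸ Finset.single_le_sum
        (f := fun q => ‖ψ q‖ ^ 2) (fun q _ => sq_nonneg _) (Finset.mem_univ p)
      rw [mem_closedBall_zero_iff]
      exact (sq_le_one_iff₀ (norm_nonneg _)).mp h3
  · unfold reducedState
    exact continuous_matrix fun i j => by simp only [Matrix.of_apply]; fun_prop

theorem isCompact_unitaryGroup (d : ℕ) :
    IsCompact (Matrix.unitaryGroup (Fin d) ℂ : Set (Matrix (Fin d) (Fin d) ℂ)) := by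
  refine IsCompact.of_isClosed_subset (isCompact_univ_pi fun _ : Fin d =>
    isCompact_univ_pi fun _ : Fin d => isCompact_closedBall (0 : ℂ) 1) ?_ ?_
  · have h : (Matrix.unitaryGroup (Fin d) ℂ : Set (Matrix (Fin d) (Fin d) ℂ))
        = {U | star U * U = 1} := by
      ext U
      exact Matrix.mem_unitaryGroup_iff'
    rw [h]
    exact isClosed_eq (by fun_prop) continuous_const
  · intro U hU i _ j _
    rw [mem_closedBall_zero_iff]
    exact entry_norm_bound_of_unitary hU i j

theorem continuousOn_diamondDist {d : ℕ} {V : Matrix (Fin d) (Fin d) ℂ}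
    (hV : V ∈ Matrix.unitaryGroup (Fin d) ℂ) :
    ContinuousOn (fun U => diamondDist (conjBy U) (conjBy V))
      (Matrix.unitaryGroup (Fin d) ℂ : Set (Matrix (Fin d) (Fin d) ℂ)) := by
  refine ContinuousOn.congr (Continuous.continuousOn ?_) fun U hU => diamondDist_conjBy hU hV
  refine (isCompact_densityMatrices d).continuous_sSup ?_
  fun_prop

/-! ### Separation of convex sets and semidefinite forms maximized on the unitary group -/

/-- A minimax statement: if every vector of a convex set has a coordinate that is at most `c`, then a
single probability vector makes all the averages at most `c`. The vector comes from a hyperplane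
separating the convex set from the orthant of vectors with all coordinates above `c`. -/
theorem exists_mem_stdSimplex_forall_sum_le {X : Type*} [Fintype X] [Nonempty X]
    {S : Set (X → ℝ)} (hS : Convex ℝ S) {c : ℝ} (h : ∀ v ∈ S, ∃ x, v x ≤ c) :
    ∃ p ∈ stdSimplex ℝ X, ∀ v ∈ S, ∑ x, p x * v x ≤ c := by
  classical
  rcases S.eq_empty_or_nonempty with rfl | ⟨v₀, hv₀⟩
  · exact ⟨_, single_mem_stdSimplex ℝ (Classical.arbitrary X), by simp⟩
  have hO : {w : X → ℝ | ∀ x, c < w x} = Set.univ.pi fun _ => Set.Ioi c := by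
    ext w; simp
  obtain ⟨f, u, hf1, hf2⟩ := geometric_hahn_banach_open
    (s := {w : X → ℝ | ∀ x, c < w x}) (t := S)
    (by rw [hO]; exact convex_pi fun _ _ => convex_Ioi c)
    (by rw [hO]; exact isOpen_set_pi Set.finite_univ fun _ _ => isOpen_Ioi) hS
    (Set.disjoint_left.mpr fun w hw hwS => by
      obtain ⟨x, hx⟩ := h w hwS
      exact absurd (hw x) (not_lt.mpr hx))
  -- `a` is the normal vector of the separating hyperplane, to be normalized in the end.
  set a : X → ℝ := fun x => -f (Pi.single x 1) with ha
  have hfa (w : X → ℝ) : f w = -∑ x, a x * w x := by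
    conv_lhs => rw [pi_eq_sum_univ' w]
    simp [ha, map_sum, mul_comm]
  have h1 (w : X → ℝ) (hw : ∀ x, c < w x) : -u < ∑ x, a x * w x := by
    have := hf1 w hw; rw [hfa] at this; linarith
  have h2 (v : X → ℝ) (hv : v ∈ S) : ∑ x, a x * v x ≤ -u := by
    have := hf2 v hv; rw [hfa] at this; linarith
  have ha0 (x : X) : 0 ≤ a x := by
    by_contra hx
    push Not at hx
    have key (t : ℝ) (ht : 0 ≤ t) : -u < (∑ y, a y * (c + 1)) + a x * t := by
      have := h1 (fun y => c + 1 + Pi.single (M := fun _ => ℝ) x t y) fun y => by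
        have : 0 ≤ Pi.single (M := fun _ => ℝ) x t y := by
          rcases eq_or_ne y x with rfl | hy
          · simpa
          · simp [hy]
        linarith
      simpa [mul_add, Finset.sum_add_distrib, Pi.single_apply] using this
    set s := ∑ y, a y * (c + 1)
    have hs := key 0 le_rfl
    have := key ((s + u) / (-a x)) (div_nonneg (by linarith) (by linarith))
    rw [mul_div_assoc', lt_iff_not_ge] at this
    apply this
    rw [show a x * (s + u) / -a x = -(s + u) by field_simp [hx.ne]]
    linarith
  have hsum : 0 < ∑ x, a x := by
    refine (Finset.sum_nonneg fun x _ => ha0 x).lt_of_ne fun h0 => ?_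
    have hz := (Finset.sum_eq_zero_iff_of_nonneg fun x _ => ha0 x).mp h0.symm
    have e1 := h1 (fun _ => c + 1) fun _ => by linarith
    have e2 := h2 v₀ hv₀
    rw [Finset.sum_eq_zero fun x hx => by rw [hz x hx, zero_mul]] at e1 e2
    linarith
  have hlim : -u ≤ (∑ x, a x) * c := by
    refine le_of_forall_pos_le_add fun η hη => ?_
    have := h1 (fun _ => c + η / ∑ x, a x) fun _ => by
      have := div_pos hη hsum
      linarith
    rw [← Finset.sum_mul, mul_add, mul_div_cancel₀ _ hsum.ne'] at this
    exact this.le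
  refine ⟨fun x => a x / ∑ y, a y, ⟨fun x => div_nonneg (ha0 x) hsum.le, ?_⟩, fun v hv => ?_⟩
  · rw [← Finset.sum_div, div_self hsum.ne']
  · simp only [div_mul_eq_mul_div]
    rw [← Finset.sum_div, div_le_iff₀ hsum, mul_comm c]
    exact (h2 v hv).trans hlim

/-- The sesquilinear form `vec(V)† Q vec(W)` on `d × d` matrices given by the matrix `Q`, where `vec`
is column stacking (`Matrix.vec`); it is conjugate linear in `V`. -/
def sesqForm {d : ℕ} (Q : Matrix (Fin d × Fin d) (Fin d × Fin d) ℂ)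
    (V W : Matrix (Fin d) (Fin d) ℂ) : ℂ :=
  star V.vec ⬝ᵥ (Q *ᵥ W.vec)

section sesqForm
variable {d : ℕ} (Q : Matrix (Fin d × Fin d) (Fin d × Fin d) ℂ)
  (U V W : Matrix (Fin d) (Fin d) ℂ) (c : ℂ)

theorem sesqForm_add_right : sesqForm Q U (V + W) = sesqForm Q U V + sesqForm Q U W := by
  simp [sesqForm, Matrix.mulVec_add]

theorem sesqForm_smul_right : sesqForm Q U (c • V) = c * sesqForm Q U V := by
  simp [sesqForm, Matrix.mulVec_smul]

theorem sesqForm_add_left : sesqForm Q (U + V) W = sesqForm Q U W + sesqForm Q V W := by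
  simp [sesqForm, add_dotProduct]

theorem sesqForm_smul_left : sesqForm Q (c • U) V = star c * sesqForm Q U V := by
  simp [sesqForm]

variable {Q}

theorem star_sesqForm (hQ : Q.IsHermitian) : star (sesqForm Q U V) = sesqForm Q V U := by
  rw [sesqForm, sesqForm, Matrix.star_dotProduct, star_star, Matrix.star_mulVec, hQ.eq,
    ← Matrix.dotProduct_mulVec]

theorem re_sesqForm_self_nonneg (hQ : Q.PosSemidef) : 0 ≤ (sesqForm Q U U).re :=
  hQ.re_dotProduct_nonneg _

theorem re_sesqForm_add_smul (hQ : Q.IsHermitian) :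
    (sesqForm Q (U + c • V) (U + c • V)).re
      = (sesqForm Q U U).re + 2 * (c * sesqForm Q U V).re
        + Complex.normSq c * (sesqForm Q V V).re := by
  rw [sesqForm_add_right, sesqForm_add_left, sesqForm_add_left, sesqForm_smul_right,
    sesqForm_smul_right, sesqForm_smul_left, sesqForm_smul_left, ← star_sesqForm U V hQ]
  simp [Complex.normSq_apply]
  ring

/-- The Cauchy–Schwarz inequality for a positive semidefinite form. -/
theorem norm_sq_sesqForm_le (hQ : Q.PosSemidef) :
    ‖sesqForm Q U V‖ ^ 2 ≤ (sesqForm Q U U).re * (sesqForm Q V V).re := by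
  set a := (sesqForm Q U U).re
  set b := (sesqForm Q V V).re
  set z := sesqForm Q U V with hz
  have ha : 0 ≤ a := re_sesqForm_self_nonneg U hQ
  have hb : 0 ≤ b := re_sesqForm_self_nonneg V hQ
  have key (t : ℝ) : 0 ≤ a + 2 * (t * ‖z‖ ^ 2) + t ^ 2 * ‖z‖ ^ 2 * b := by
    have h := re_sesqForm_self_nonneg (U + ((t : ℂ) * star z) • V) hQ
    rw [re_sesqForm_add_smul _ _ _ hQ.1, ← hz] at h
    have h1 : ((t : ℂ) * star z * z).re = t * ‖z‖ ^ 2 := by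
      rw [mul_assoc, Complex.star_def, Complex.conj_mul', Complex.re_ofReal_mul]
      norm_cast
    have h2 : Complex.normSq ((t : ℂ) * star z) = t ^ 2 * ‖z‖ ^ 2 := by
      rw [Complex.normSq_eq_norm_sq, norm_mul, norm_star, Complex.norm_real, mul_pow,
        Real.norm_eq_abs, sq_abs]
    rwa [h1, h2] at h
  have hdis := discrim_le_zero (a := ‖z‖ ^ 2 * b) (b := 2 * ‖z‖ ^ 2) (c := a)
    fun t => by linarith [key t]
  rw [discrim] at hdis
  rcases (sq_nonneg ‖z‖).eq_or_lt with h0 | h0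
  · rw [← h0]; exact mul_nonneg ha hb
  · nlinarith

theorem continuous_re_sesqForm : Continuous fun U => (sesqForm Q U U).re := by
  unfold sesqForm Matrix.vec
  fun_prop
end sesqForm

/-- Over `ℂ`, nonnegativity of the quadratic form on unit vectors already gives positive
semidefiniteness, including Hermitian symmetry. -/
theorem posSemidef_of_unit_dotProduct_nonneg {n : Type*} [Fintype n] [DecidableEq n]
    {T : Matrix n n ℂ} (h : ∀ φ : n → ℂ, star φ ⬝ᵥ φ = 1 → 0 ≤ star φ ⬝ᵥ (T *ᵥ φ)) :
    T.PosSemidef := by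
  have hall (φ : n → ℂ) : 0 ≤ star φ ⬝ᵥ (T *ᵥ φ) := by
    have hn : star φ ⬝ᵥ φ = ((∑ i, ‖φ i‖ ^ 2 : ℝ) : ℂ) := by
      simp [dotProduct, Complex.conj_mul']
    set r := ∑ i, ‖φ i‖ ^ 2 with hr
    have hr0 : 0 ≤ r := Finset.sum_nonneg fun i _ => sq_nonneg _
    rcases hr0.eq_or_lt with h0 | hpos
    · rw [← h0, Complex.ofReal_zero, dotProduct_star_self_eq_zero] at hn
      simp [hn]
    · have hs : ((√r : ℝ) : ℂ)⁻¹ * ((√r : ℝ) : ℂ)⁻¹ = (r : ℂ)⁻¹ := by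
        rw [← mul_inv, ← Complex.ofReal_mul, Real.mul_self_sqrt hr0]
      have hrc : (r : ℂ) ≠ 0 := by exact_mod_cast hpos.ne'
      have h1 := h (((√r : ℝ) : ℂ)⁻¹ • φ) (by
        rw [star_smul, smul_dotProduct, dotProduct_smul, hn, smul_eq_mul, smul_eq_mul, ← mul_assoc]
        simp only [Complex.star_def, map_inv₀, Complex.conj_ofReal]
        rw [hs, inv_mul_cancel₀ hrc])
      rw [star_smul, Matrix.mulVec_smul, smul_dotProduct, dotProduct_smul, smul_eq_mul,
        smul_eq_mul, ← mul_assoc] at h1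
      simp only [Complex.star_def, map_inv₀, Complex.conj_ofReal] at h1
      rw [hs] at h1
      have h2 := mul_nonneg (show (0 : ℂ) ≤ r by exact_mod_cast hr0) h1
      rwa [mul_inv_cancel_left₀ hrc] at h2
  rw [← Matrix.isPositive_toEuclideanLin_iff, LinearMap.isPositive_iff_complex]
  intro x
  have hx : inner ℂ (Matrix.toEuclideanLin T x) x = star (star x.ofLp ⬝ᵥ (T *ᵥ x.ofLp)) := by
    rw [EuclideanSpace.inner_eq_star_dotProduct, ← Matrix.star_dotProduct_star, star_star,
      dotProduct_comm]
    rfl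
  obtain ⟨h1, h2⟩ := Complex.nonneg_iff.mp (hall x.ofLp)
  rw [hx]
  constructor
  · apply Complex.ext
    · simp
    · simpa using h2.symm
  · simpa using h1

/-- The condition on `c` says `|1 + c| = 1`: the matrix multiplies `φ` by a phase and fixes its
orthogonal complement. -/
theorem one_add_smul_vecMulVec_mem_unitaryGroup {n : Type*} [Fintype n] [DecidableEq n]
    {φ : n → ℂ} (hφ : star φ ⬝ᵥ φ = 1) {c : ℂ} (hc : c + star c + star c * c = 0) :
    1 + c • Matrix.vecMulVec φ (star φ) ∈ Matrix.unitaryGroup n ℂ := by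
  rw [Matrix.mem_unitaryGroup_iff', Matrix.star_eq_conjTranspose]
  set A := Matrix.vecMulVec φ (star φ) with hA
  have hAA : A * A = A := by
    rw [hA, Matrix.vecMulVec_mul_vecMulVec, hφ, one_smul]
  have hAh : Aᴴ = A := by simp [hA, Matrix.conjTranspose_vecMulVec]
  rw [Matrix.conjTranspose_add, Matrix.conjTranspose_one, Matrix.conjTranspose_smul, hAh, add_mul,
    mul_add, mul_add, one_mul, one_mul, mul_one, Matrix.smul_mul, Matrix.mul_smul, hAA, smul_smul,
    add_assoc, ← add_smul, ← add_smul, ← add_assoc, hc, zero_smul, add_zero]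

/-- If a positive semidefinite form, restricted to the unitary group, is maximal at `V`, then the
linear functional `W ↦ Q(V, V W)` is a positive multiple of the expectation in a state `ρ`. Its
positivity on `φ φ†` follows by comparing `V` with `V (1 + c φ φ†)`, `|1 + c| = 1`. -/
theorem exists_densityMatrix_of_isMax {d : ℕ} {Q : Matrix (Fin d × Fin d) (Fin d × Fin d) ℂ}
    (hQ : Q.PosSemidef) {V : Matrix (Fin d) (Fin d) ℂ} (hV : V ∈ Matrix.unitaryGroup (Fin d) ℂ)
    (hmax : ∀ U ∈ Matrix.unitaryGroup (Fin d) ℂ, (sesqForm Q U U).re ≤ (sesqForm Q V V).re)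
    (hpos : 0 < (sesqForm Q V V).re) :
    ∃ ρ ∈ densityMatrices d, ∀ W,
      sesqForm Q V (V * W) = ((sesqForm Q V V).re : ℂ) * (W * ρ).trace := by
  set T : Matrix (Fin d) (Fin d) ℂ :=
    Matrix.of fun j i => sesqForm Q V (V * Matrix.single i j 1) with hT
  have htr (W : Matrix (Fin d) (Fin d) ℂ) : (W * T).trace = sesqForm Q V (V * W) := by
    let ℓ : Matrix (Fin d) (Fin d) ℂ →ₗ[ℂ] ℂ :=
      { toFun := fun W => sesqForm Q V (V * W)
        map_add' := fun A B => by rw [mul_add, sesqForm_add_right]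
        map_smul' := fun c A => by rw [Matrix.mul_smul, sesqForm_smul_right]; rfl }
    have h1 : sesqForm Q V (V * W) = ℓ W := rfl
    have h2 (i j : Fin d) : ℓ (Matrix.single i j (W i j)) = W i j * T j i := by
      rw [show Matrix.single i j (W i j) = W i j • Matrix.single i j (1 : ℂ) by simp, map_smul]
      rfl
    rw [h1]
    conv_rhs => rw [Matrix.matrix_eq_sum_single W]
    simp only [map_sum, h2, Matrix.trace, Matrix.diag_apply, Matrix.mul_apply]
  have hVV : ((sesqForm Q V V).re : ℂ) = sesqForm Q V V :=
    Complex.conj_eq_iff_re.mp (star_sesqForm V V hQ.1)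
  have hunit (φ : Fin d → ℂ) (hφ : star φ ⬝ᵥ φ = 1) :
      0 ≤ sesqForm Q V (V * Matrix.vecMulVec φ (star φ)) := by
    set z := sesqForm Q V (V * Matrix.vecMulVec φ (star φ)) with hz
    have key (t : ℝ) : 0 ≤ t ^ 2 * z.re + t * z.im := by
      have ht : 0 < 1 + t ^ 2 := by positivity
      -- `1 + c = (1 + i t) / (1 - i t)` runs through the unit circle.
      set c : ℂ := ⟨-2 * t ^ 2 / (1 + t ^ 2), 2 * t / (1 + t ^ 2)⟩ with hc
      have hcc : c + star c + star c * c = 0 := by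
        apply Complex.ext
        · simp [hc]; field_simp; ring
        · simp [hc]; ring
      have h1 := hmax _ (mul_mem hV (one_add_smul_vecMulVec_mem_unitaryGroup hφ hcc))
      rw [mul_add, mul_one, Matrix.mul_smul, re_sesqForm_add_smul _ _ _ hQ.1, ← hz] at h1
      have h2 : 0 ≤ Complex.normSq c * (sesqForm Q (V * Matrix.vecMulVec φ (star φ))
          (V * Matrix.vecMulVec φ (star φ))).re :=
        mul_nonneg (Complex.normSq_nonneg c) (re_sesqForm_self_nonneg _ hQ)
      have h3 : (c * z).re ≤ 0 := by linarith
      have h4 : (c * z).re = -2 * (t ^ 2 * z.re + t * z.im) / (1 + t ^ 2) := by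
        simp [hc, Complex.mul_re]; field_simp; ring
      rw [h4, div_le_iff₀ ht] at h3
      linarith
    have ha : 0 ≤ z.re := by linarith [key 1, key (-1)]
    have hb : z.im = 0 := by
      -- For this `t` the nonnegative expression in `key` equals `-(z.im / (z.re + 1)) ^ 2`.
      have h := key (-z.im / (z.re + 1))
      have h5 : (-z.im / (z.re + 1)) ^ 2 * z.re + -z.im / (z.re + 1) * z.im
          = -(z.im / (z.re + 1)) ^ 2 := by
        have : z.re + 1 ≠ 0 := by positivity
        field_simp; ring
      rw [h5] at h
      have h6 : (z.im / (z.re + 1)) ^ 2 = 0 := le_antisymm (by linarith) (sq_nonneg _)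
      have h7 := pow_eq_zero_iff (two_ne_zero) |>.mp h6
      rcases div_eq_zero_iff.mp h7 with h8 | h8
      · exact h8
      · linarith
    exact Complex.nonneg_iff.mpr ⟨ha, hb.symm⟩
  have hTpos : T.PosSemidef := by
    refine posSemidef_of_unit_dotProduct_nonneg fun φ hφ => ?_
    have hφT : star φ ⬝ᵥ (T *ᵥ φ) = sesqForm Q V (V * Matrix.vecMulVec φ (star φ)) := by
      rw [← htr, Matrix.vecMulVec_mul, Matrix.trace_vecMulVec, dotProduct_comm φ,
        ← Matrix.dotProduct_mulVec]
    rw [hφT]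
    exact hunit φ hφ
  refine ⟨((sesqForm Q V V).re⁻¹ : ℂ) • T, ⟨hTpos.smul ?_, ?_⟩, fun W => ?_⟩
  · exact_mod_cast (inv_pos.mpr hpos).le
  · have h := htr 1
    rw [one_mul, mul_one] at h
    rw [Matrix.trace_smul, h, smul_eq_mul]
    conv_lhs => rw [← hVV]
    rw [Complex.ofReal_re]
    exact inv_mul_cancel₀ (by exact_mod_cast hpos.ne')
  · rw [Matrix.mul_smul, Matrix.trace_smul, htr, smul_eq_mul, mul_inv_cancel_left₀]
    exact_mod_cast hpos.ne'

/-! ### The trace of a unitary matrix and its numerical range -/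

/-- Moving from a weight `w ≥ 1/2` of a point `a` of the unit circle to weight `1/2` does not increase
the modulus of the combination of `a` with a point `m` of the disc. -/
theorem norm_midpoint_le {a m : ℂ} (ha : ‖a‖ = 1) (hm : ‖m‖ ≤ 1) {w : ℝ} (h0 : 1 / 2 ≤ w)
    (h1 : w ≤ 1) : ‖(1 / 2 : ℂ) * a + (1 / 2 : ℂ) * m‖ ≤ ‖(w : ℂ) * a + (1 - w : ℂ) * m‖ := by
  have hre : (a * starRingEnd ℂ m).re ≤ ‖m‖ := by
    calc (a * starRingEnd ℂ m).re ≤ ‖a * starRingEnd ℂ m‖ := Complex.re_le_norm _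
      _ = ‖m‖ := by rw [norm_mul, ha, one_mul, RCLike.norm_conj]
  have key (t : ℝ) : ‖(t : ℂ) * a + (1 - t : ℂ) * m‖ ^ 2
      = t ^ 2 + (1 - t) ^ 2 * ‖m‖ ^ 2 + 2 * t * (1 - t) * (a * starRingEnd ℂ m).re := by
    have e := Complex.normSq_add ((t : ℂ) * a) ((1 - t : ℂ) * m)
    have e1 : ((t : ℂ) * a * starRingEnd ℂ ((1 - t : ℂ) * m)).re = t * (1 - t) * (a * starRingEnd ℂ m).re := by
      simp; ring
    rw [← Complex.normSq_eq_norm_sq, e, e1, Complex.normSq_eq_norm_sq, Complex.normSq_eq_norm_sq,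
      norm_mul, norm_mul, ha, Complex.norm_real,
      show (1 - t : ℂ) = ((1 - t : ℝ) : ℂ) by push_cast; rfl, Complex.norm_real, mul_pow, mul_pow,
      Real.norm_eq_abs, Real.norm_eq_abs, sq_abs, sq_abs]
    ring
  refine (pow_le_pow_iff_left₀ (norm_nonneg _) (norm_nonneg _) two_ne_zero).mp ?_
  have k1 := key (1 / 2)
  rw [show ((1 / 2 : ℝ) : ℂ) = 1 / 2 by push_cast; rfl,
    show (1 - 1 / 2 : ℂ) = 1 / 2 by norm_num] at k1
  rw [key w, k1]
  have hn : 0 ≤ ‖m‖ := norm_nonneg m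
  have p1 := mul_nonneg (sq_nonneg (w - 1 / 2)) (sub_nonneg.mpr hre)
  have p2 : 0 ≤ (w - 1 / 2) * (1 - ‖m‖) * (w + (1 - w) * ‖m‖ + (1 + ‖m‖) / 2) :=
    mul_nonneg (mul_nonneg (by linarith) (by linarith))
      (by nlinarith [mul_nonneg (sub_nonneg.mpr h1) hn])
  linarith

/-- If all weights are at most `1/2`, this is the triangle inequality for
`∑ z i = ∑ (1 - 2 w i) z i + 2 ∑ w i z i`. A weight above `1/2` can be lowered to `1/2`, the others
being scaled up, without increasing `‖∑ w i z i‖`. -/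
theorem norm_sum_le_of_convexCombination {n : Type*} [Fintype n] {z : n → ℂ}
    (hz : ∀ i, ‖z i‖ = 1) {w : n → ℝ} (hw : w ∈ stdSimplex ℝ n) :
    ‖∑ i, z i‖ ≤ Fintype.card n - 2 + 2 * ‖∑ i, (w i : ℂ) * z i‖ := by
  classical
  have small (w : n → ℝ) (hw : w ∈ stdSimplex ℝ n) (hw2 : ∀ i, w i ≤ 1 / 2) :
      ‖∑ i, z i‖ ≤ Fintype.card n - 2 + 2 * ‖∑ i, (w i : ℂ) * z i‖ := by
    have h1 : ∑ i, z i = ∑ i, ((1 - 2 * w i : ℝ) : ℂ) * z i + 2 * ∑ i, (w i : ℂ) * z i := by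
      rw [Finset.mul_sum, ← Finset.sum_add_distrib]
      refine Finset.sum_congr rfl fun i _ => ?_
      push_cast; ring
    have h2 : ‖∑ i, ((1 - 2 * w i : ℝ) : ℂ) * z i‖ ≤ Fintype.card n - 2 := by
      calc _ ≤ ∑ i, ‖((1 - 2 * w i : ℝ) : ℂ) * z i‖ := norm_sum_le _ _
        _ = ∑ i, (1 - 2 * w i) := Finset.sum_congr rfl fun i _ => by
          rw [norm_mul, hz, mul_one, Complex.norm_real, Real.norm_of_nonneg]
          linarith [hw2 i]
        _ = Fintype.card n - 2 := by
          rw [Finset.sum_sub_distrib, ← Finset.mul_sum, hw.2]; simp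
    rw [h1]
    refine (norm_add_le _ _).trans (add_le_add h2 ?_)
    rw [norm_mul, Complex.norm_ofNat]
  by_cases hbig : ∀ i, w i ≤ 1 / 2
  · exact small w hw hbig
  push Not at hbig
  obtain ⟨i, hi⟩ := hbig
  have hsum : w i + ∑ j ∈ Finset.univ.erase i, w j = 1 := by
    rw [Finset.add_sum_erase _ _ (Finset.mem_univ i), hw.2]
  have hsumz : (w i : ℂ) * z i + ∑ j ∈ Finset.univ.erase i, (w j : ℂ) * z j
      = ∑ j, (w j : ℂ) * z j :=
    Finset.add_sum_erase _ (fun j => (w j : ℂ) * z j) (Finset.mem_univ i)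
  have hle : w i ≤ 1 := by
    linarith [Finset.sum_nonneg fun j (_ : j ∈ Finset.univ.erase i) => hw.1 j]
  rcases hle.eq_or_lt with h1 | h1
  · have h0 : ∑ j ∈ Finset.univ.erase i, w j = 0 := by linarith
    have h2 : ∑ j ∈ Finset.univ.erase i, (w j : ℂ) * z j = 0 :=
      Finset.sum_eq_zero fun j hj => by
        rw [(Finset.sum_eq_zero_iff_of_nonneg fun j _ => hw.1 j).mp h0 j hj]; simp
    rw [← hsumz, h2, h1, add_zero, Complex.ofReal_one, one_mul, hz]
    calc ‖∑ i, z i‖ ≤ ∑ i, ‖z i‖ := norm_sum_le _ _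
      _ = Fintype.card n - 2 + 2 * 1 := by simp [hz]
  · set r : ℝ := 1 - w i with hr
    have hr0 : 0 < r := by linarith
    have hrest : ∑ j ∈ Finset.univ.erase i, w j = r := by linarith
    set w' : n → ℝ := fun j => if j = i then 1 / 2 else w j / (2 * r) with hw'
    have hwi : w' i = 1 / 2 := by simp [hw']
    have hwj {j : n} (hj : j ∈ Finset.univ.erase i) : w' j = w j / (2 * r) := by
      simp [hw', Finset.ne_of_mem_erase hj]
    have hw'0 (j : n) : 0 ≤ w' j := by
      by_cases h : j = i
      · simp [hw', h]
      · simp only [hw', h, if_false]; exact div_nonneg (hw.1 j) (by linarith)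
    have hw's : ∑ j ∈ Finset.univ.erase i, w' j = 1 / 2 := by
      rw [Finset.sum_congr rfl fun j hj => hwj hj, ← Finset.sum_div, hrest]
      field_simp
    have hw'mem : w' ∈ stdSimplex ℝ n := by
      refine ⟨hw'0, ?_⟩
      rw [← Finset.add_sum_erase _ _ (Finset.mem_univ i), hw's, hwi]; norm_num
    have hw'le (j : n) : w' j ≤ 1 / 2 := by
      by_cases h : j = i
      · rw [h, hwi]
      · rw [← hw's]
        exact Finset.single_le_sum (fun k _ => hw'0 k)
          (Finset.mem_erase.mpr ⟨h, Finset.mem_univ j⟩)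
    refine (small w' hw'mem hw'le).trans ?_
    set m : ℂ := ∑ j ∈ Finset.univ.erase i, ((w j / r : ℝ) : ℂ) * z j with hm
    have hm1 : ‖m‖ ≤ 1 := by
      calc ‖m‖ ≤ ∑ j ∈ Finset.univ.erase i, ‖((w j / r : ℝ) : ℂ) * z j‖ := norm_sum_le _ _
        _ = ∑ j ∈ Finset.univ.erase i, w j / r := Finset.sum_congr rfl fun j _ => by
          rw [norm_mul, hz, mul_one, Complex.norm_real,
            Real.norm_of_nonneg (div_nonneg (hw.1 j) hr0.le)]
        _ = 1 := by rw [← Finset.sum_div, hrest, div_self hr0.ne']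
    have hrc : (r : ℂ) ≠ 0 := by exact_mod_cast hr0.ne'
    have e1 : ∑ j, (w' j : ℂ) * z j = (1 / 2 : ℂ) * z i + (1 / 2 : ℂ) * m := by
      rw [← Finset.add_sum_erase _ _ (Finset.mem_univ i), hwi, hm, Finset.mul_sum]
      congr 1
      · push_cast; rfl
      · refine Finset.sum_congr rfl fun j hj => ?_
        rw [hwj hj]; push_cast; field_simp
    have e2 : ∑ j, (w j : ℂ) * z j = (w i : ℂ) * z i + (1 - w i : ℂ) * m := by
      rw [← hsumz, hm, Finset.mul_sum]
      congr 1
      refine Finset.sum_congr rfl fun j hj => ?_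
      rw [show (1 - w i : ℂ) = (r : ℂ) by rw [hr]; push_cast; rfl]
      push_cast; field_simp
    rw [e1, e2]
    linarith [norm_midpoint_le (hz i) hm1 hi.le hle]

/-- The spectral theorem for unitary matrices, from the one for Hermitian matrices by a Cayley
transform. -/
theorem exists_unitary_diagonalization {d : ℕ} {W : Matrix (Fin d) (Fin d) ℂ}
    (hW : W ∈ Matrix.unitaryGroup (Fin d) ℂ) :
    ∃ V ∈ Matrix.unitaryGroup (Fin d) ℂ, ∃ z : Fin d → ℂ, (∀ i, ‖z i‖ = 1) ∧
      W = V * Matrix.diagonal z * Vᴴ := by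
  have hWl : Wᴴ * W = 1 := Matrix.mem_unitaryGroup_iff'.mp hW
  have hWr : W * Wᴴ = 1 := Matrix.mem_unitaryGroup_iff.mp hW
  obtain ⟨ζ, hζ, hdet⟩ : ∃ ζ : ℂ, ‖ζ‖ = 1 ∧ IsUnit (W + ζ • (1 : Matrix (Fin d) (Fin d) ℂ)) := by
    have hinf : (Metric.sphere (0 : ℂ) 1).Infinite :=
      (isPreconnected_sphere (by rw [Complex.rank_real_complex]; norm_num) 0 1).infinite_of_nontrivial
        ⟨1, by simp, -1, by simp, by norm_num⟩
    have hfin : (spectrum ℂ W).Finite := Matrix.finite_spectrum W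
    obtain ⟨ζ, h1, h2⟩ := hinf.exists_notMem_finite hfin
    refine ⟨-ζ, by simpa using h1, ?_⟩
    have := (spectrum.notMem_iff.mp h2).neg
    rwa [Algebra.algebraMap_eq_smul_one, neg_sub, sub_eq_add_neg, ← neg_smul] at this
  set S := W + ζ • (1 : Matrix (Fin d) (Fin d) ℂ) with hS
  obtain ⟨R, hSR, hRS⟩ : ∃ R, S * R = 1 ∧ R * S = 1 := by
    obtain ⟨u, hu⟩ := hdet
    exact ⟨↑u⁻¹, by rw [← hu]; simp, by rw [← hu]; simp⟩
  have hζ1 : star ζ * ζ = 1 := by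
    simpa [hζ] using Complex.conj_mul' ζ
  -- The Cayley transform of `W`, with the pole `-ζ` outside the spectrum of `W`.
  set K := (Complex.I • (ζ • (1 : Matrix (Fin d) (Fin d) ℂ) - W)) * R with hK
  have hKS : K * S = Complex.I • (ζ • (1 : Matrix (Fin d) (Fin d) ℂ) - W) := by
    rw [hK, mul_assoc, hRS, mul_one]
  have hKH : K.IsHermitian := by
    have h1 : Sᴴ * K * S = Sᴴ * Kᴴ * S := by
      rw [mul_assoc, hKS, ← Matrix.conjTranspose_mul, hKS]
      simp only [hS, Matrix.conjTranspose_add, Matrix.conjTranspose_smul, Matrix.conjTranspose_sub,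
        Matrix.conjTranspose_one, mul_add, add_mul, mul_sub, sub_mul, Matrix.smul_mul,
        Matrix.mul_smul, hWl, one_mul, mul_one, smul_sub, smul_smul]
      simp only [Complex.star_def, map_mul, Complex.conj_I] at hζ1 ⊢
      match_scalars <;> first | ring1 | linear_combination (2 * Complex.I) * hζ1
    have h2 : Rᴴ * Sᴴ = 1 := by rw [← Matrix.conjTranspose_mul, hSR, Matrix.conjTranspose_one]
    have h3 : Rᴴ * (Sᴴ * K * S) * R = K := by
      rw [mul_assoc Sᴴ, ← mul_assoc, h2, one_mul, mul_assoc, hSR, mul_one]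
    have h4 : Rᴴ * (Sᴴ * Kᴴ * S) * R = Kᴴ := by
      rw [mul_assoc Sᴴ, ← mul_assoc, h2, one_mul, mul_assoc, hSR, mul_one]
    rw [Matrix.IsHermitian, ← h4, ← h1, h3]
  set V : Matrix (Fin d) (Fin d) ℂ := (hKH.eigenvectorUnitary).1 with hV
  have hVmem : V ∈ Matrix.unitaryGroup (Fin d) ℂ := hKH.eigenvectorUnitary.2
  have hVl : Vᴴ * V = 1 := Matrix.mem_unitaryGroup_iff'.mp hVmem
  have hVr : V * Vᴴ = 1 := Matrix.mem_unitaryGroup_iff.mp hVmem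
  set l : Fin d → ℝ := hKH.eigenvalues with hl
  have hspec : K = V * Matrix.diagonal (fun i => (l i : ℂ)) * Vᴴ := by
    have := hKH.spectral_theorem
    rw [Unitary.conjStarAlgAut_apply] at this
    exact this
  set D := Vᴴ * W * V with hD
  have hWD : W = V * D * Vᴴ := by
    rw [hD, mul_assoc, mul_assoc, mul_assoc, hVr, mul_one, ← mul_assoc, hVr, one_mul]
  have hrel : Matrix.diagonal (fun i => (l i : ℂ)) * (D + ζ • 1) = Complex.I • (ζ • 1 - D) := by
    have h1 := congrArg (fun M => Vᴴ * M * V) hKS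
    simp only [hspec, hS] at h1
    have e1 : Vᴴ * (V * Matrix.diagonal (fun i => (l i : ℂ)) * Vᴴ * (W + ζ • 1)) * V
        = Matrix.diagonal (fun i => (l i : ℂ)) * (D + ζ • 1) := by
      rw [hD]
      calc _ = (Vᴴ * V) * Matrix.diagonal (fun i => (l i : ℂ)) * (Vᴴ * (W + ζ • 1) * V) := by
            simp only [mul_assoc]
        _ = _ := by
            rw [hVl, one_mul, mul_add, add_mul, Matrix.mul_smul, Matrix.smul_mul, mul_one, hVl]
    have e2 : Vᴴ * (Complex.I • (ζ • (1 : Matrix (Fin d) (Fin d) ℂ) - W)) * V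
        = Complex.I • (ζ • 1 - D) := by
      rw [hD, Matrix.mul_smul, Matrix.smul_mul, mul_sub, sub_mul, Matrix.mul_smul, Matrix.smul_mul,
        mul_one, hVl]
    rw [← e1, ← e2, h1]
  have hne (i : Fin d) : (l i : ℂ) + Complex.I ≠ 0 := by
    intro h
    have := congrArg Complex.im h
    simp at this
  have hdiag (i j : Fin d) (hij : i ≠ j) : D i j = 0 := by
    have h1 := congrFun (congrFun hrel i) j
    simp [Matrix.diagonal_mul, hij] at h1
    have : ((l i : ℂ) + Complex.I) * D i j = 0 := by linear_combination h1
    exact (mul_eq_zero.mp this).resolve_left (hne i)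
  have hDdiag : D = Matrix.diagonal D.diag := by
    ext i j
    rcases eq_or_ne i j with rfl | hij
    · simp
    · simp [hdiag i j hij, hij]
  have hDmem : D ∈ Matrix.unitaryGroup (Fin d) ℂ :=
    mul_mem (mul_mem (Unitary.star_mem hVmem) hW) hVmem
  refine ⟨V, hVmem, D.diag, fun i => ?_, by rw [← hDdiag, ← hWD]⟩
  have h1 : Dᴴ * D = 1 := Matrix.mem_unitaryGroup_iff'.mp hDmem
  rw [hDdiag, Matrix.diagonal_conjTranspose, Matrix.diagonal_mul_diagonal] at h1
  have h2 := congrFun (congrFun h1 i) i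
  simp [Complex.conj_mul'] at h2
  rcases h2 with h2 | h2
  · exact h2
  · have h3 : ‖D i i‖ = -1 := by exact_mod_cast h2
    linarith [norm_nonneg (D i i)]

theorem norm_trace_le_of_densityMatrix {d : ℕ} {W ρ : Matrix (Fin d) (Fin d) ℂ}
    (hW : W ∈ Matrix.unitaryGroup (Fin d) ℂ) (hρ : ρ ∈ densityMatrices d) :
    ‖W.trace‖ ≤ d - 2 + 2 * ‖(W * ρ).trace‖ := by
  obtain ⟨V, hV, z, hz, rfl⟩ := exists_unitary_diagonalization hW
  have hVl : Vᴴ * V = 1 := Matrix.mem_unitaryGroup_iff'.mp hV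
  have hVr : V * Vᴴ = 1 := Matrix.mem_unitaryGroup_iff.mp hV
  set σ := Vᴴ * ρ * V with hσdef
  have hσ : σ.PosSemidef := hρ.1.conjTranspose_mul_mul_same V
  have hσtr : σ.trace = 1 := by
    rw [hσdef, Matrix.trace_mul_comm, ← mul_assoc, hVr, one_mul, hρ.2]
  have hdiag (i : Fin d) : 0 ≤ (σ i i).re ∧ (((σ i i).re : ℝ) : ℂ) = σ i i := by
    obtain ⟨h1, h2⟩ := Complex.nonneg_iff.mp (hσ.diag_nonneg (i := i))
    exact ⟨h1, Complex.ext rfl h2⟩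
  have hw : (fun i => (σ i i).re) ∈ stdSimplex ℝ (Fin d) := by
    refine ⟨fun i => (hdiag i).1, ?_⟩
    rw [← Complex.re_sum]
    exact congrArg Complex.re hσtr
  -- The diagonal of `ρ` in an eigenbasis of `W` gives the weights of the eigenvalues in `tr (W ρ)`.
  have h := norm_sum_le_of_convexCombination hz hw
  have e1 : (V * Matrix.diagonal z * Vᴴ).trace = ∑ i, z i := by
    rw [Matrix.trace_mul_comm, ← mul_assoc, hVl, one_mul, Matrix.trace_diagonal]
  have e2 : (V * Matrix.diagonal z * Vᴴ * ρ).trace = ∑ i, ((σ i i).re : ℂ) * z i := by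
    rw [mul_assoc, mul_assoc, Matrix.trace_mul_comm, mul_assoc, Matrix.trace]
    refine Finset.sum_congr rfl fun i _ => ?_
    rw [(hdiag i).2, hσdef, Matrix.diag_apply, Matrix.diagonal_mul, mul_comm]
  rw [e1, e2]
  simpa using h

/-! ### Distance of a unitary transformation from a mixture -/

/-- The positive semidefinite forms on `d × d` matrices that are at most `1` on the unitary group.
This convex set contains the acceptance probabilities of all tests, see `testForms`. -/
def acceptanceForms (d : ℕ) : Set (Matrix (Fin d × Fin d) (Fin d × Fin d) ℂ) :=
  {Q | Q.PosSemidef ∧ ∀ U ∈ Matrix.unitaryGroup (Fin d) ℂ, (sesqForm Q U U).re ≤ 1}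

/-- The matrix of the linear map `vec(W) ↦ (W ⊗ 1) ψ`, where `vec` is column stacking, so that the
entry `W i j` has index `(j, i)`. -/
def actionMatrix {d k : ℕ} (ψ : Fin d × Fin k → ℂ) : Matrix (Fin d × Fin k) (Fin d × Fin d) ℂ :=
  Matrix.of fun q p => if p.2 = q.1 then ψ (p.1, q.2) else 0

/-- The forms whose value at `W` is the probability `⟨(W ⊗ 1) ψ, P (W ⊗ 1) ψ⟩` that the effect `P`
accepts the output on the input `ψ`, for a unit vector `ψ` with an ancilla of any dimension and
`0 ≤ P ≤ 1`. -/
def testForms (d : ℕ) : Set (Matrix (Fin d × Fin d) (Fin d × Fin d) ℂ) :=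
  {Q | ∃ (k : ℕ) (ψ : Fin d × Fin k → ℂ) (P : Matrix (Fin d × Fin k) (Fin d × Fin k) ℂ),
    star ψ ⬝ᵥ ψ = 1 ∧ P ∈ Set.Icc 0 1 ∧ Q = (actionMatrix ψ)ᴴ * P * actionMatrix ψ}

theorem sesqForm_actionMatrix {d k : ℕ} (ψ : Fin d × Fin k → ℂ)
    (P : Matrix (Fin d × Fin k) (Fin d × Fin k) ℂ) (W : Matrix (Fin d) (Fin d) ℂ) :
    sesqForm ((actionMatrix ψ)ᴴ * P * actionMatrix ψ) W W
      = star (actOnFirst W ψ) ⬝ᵥ (P *ᵥ actOnFirst W ψ) := by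
  have h : actionMatrix ψ *ᵥ W.vec = actOnFirst W ψ := by
    ext q
    simp only [actionMatrix, actOnFirst, Matrix.mulVec, dotProduct, Matrix.of_apply, Matrix.vec,
      Fintype.sum_prod_type, ite_mul, zero_mul]
    simp [mul_comm]
  rw [sesqForm, ← Matrix.mulVec_mulVec, h, ← Matrix.mulVec_mulVec, Matrix.dotProduct_mulVec,
    ← Matrix.star_mulVec, h]

theorem testForms_subset_acceptanceForms (d : ℕ) : testForms d ⊆ acceptanceForms d := by
  rintro _ ⟨k, ψ, P, hψ, ⟨h0, h1⟩, rfl⟩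
  refine ⟨(Matrix.nonneg_iff_posSemidef.mp h0).conjTranspose_mul_mul_same _, fun U hU => ?_⟩
  have h := (Matrix.le_iff.mp h1).re_dotProduct_nonneg (actOnFirst U ψ)
  rw [sesqForm_actionMatrix]
  rw [Matrix.sub_mulVec, Matrix.one_mulVec, dotProduct_sub, star_actOnFirst_dotProduct_self hU,
    hψ] at h
  simpa using h

theorem convex_acceptanceForms (d : ℕ) : Convex ℝ (acceptanceForms d) := by
  intro Q hQ R hR a b ha hb hab
  have hlin (W : Matrix (Fin d) (Fin d) ℂ) : (sesqForm (a • Q + b • R) W W).re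
      = a * (sesqForm Q W W).re + b * (sesqForm R W W).re := by
    simp [sesqForm, Matrix.add_mulVec, Matrix.smul_mulVec]
  refine ⟨(hQ.1.smul ha).add (hR.1.smul hb), fun U hU => ?_⟩
  rw [hlin]
  nlinarith [hQ.2 U hU, hR.2 U hU]

/-- The excess of the value of the form `Q` at `U` over its value at each `Us x`. -/
def advantage {d : ℕ} {X : Type*} (U : Matrix (Fin d) (Fin d) ℂ)
    (Us : X → Matrix (Fin d) (Fin d) ℂ) (Q : Matrix (Fin d × Fin d) (Fin d × Fin d) ℂ) : X → ℝ :=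
  fun x => (sesqForm Q U U).re - (sesqForm Q (Us x) (Us x)).re

section mixture
variable {d : ℕ} {X : Type*} [Fintype X] {U : Matrix (Fin d) (Fin d) ℂ}
  {Us : X → Matrix (Fin d) (Fin d) ℂ} {p : X → ℝ}

theorem isGreatest_traceDist_ampliate_mixture
    (hU : U ∈ Matrix.unitaryGroup (Fin d) ℂ) (hUs : ∀ x, Us x ∈ Matrix.unitaryGroup (Fin d) ℂ)
    (hp : p ∈ stdSimplex ℝ X) {k : ℕ} {ψ : Fin d × Fin k → ℂ} (hψ : star ψ ⬝ᵥ ψ = 1) :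
    IsGreatest ((fun P : Matrix (Fin d × Fin k) (Fin d × Fin k) ℂ => ∑ x, p x *
        advantage U Us ((actionMatrix ψ)ᴴ * P * actionMatrix ψ) x) '' Set.Icc 0 1)
      (traceDist (ampliate (conjBy U - mixture (fun x => conjBy (Us x)) p) k
        (Matrix.vecMulVec ψ (star ψ)))) := by
  set H := ampliate (conjBy U - mixture (fun x => conjBy (Us x)) p) k
        (Matrix.vecMulVec ψ (star ψ)) with hHdef
  -- Since `∑ p x = 1`, the output difference is a mixture of differences of pure states.
  have hH : H = ∑ x, (p x : ℂ) •
      (Matrix.vecMulVec (actOnFirst U ψ) (star (actOnFirst U ψ))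
        - Matrix.vecMulVec (actOnFirst (Us x) ψ) (star (actOnFirst (Us x) ψ))) := by
    have h1 : ∑ x, (p x : ℂ) = 1 := by exact_mod_cast hp.2
    simp only [smul_sub, Finset.sum_sub_distrib, ← Finset.sum_smul, h1, one_smul, hHdef,
      ← ampliate_conjBy]
    ext q r
    simp [ampliate, mixture, Matrix.sum_apply]
  have htrv (V : Matrix (Fin d) (Fin d) ℂ) (hV : V ∈ Matrix.unitaryGroup (Fin d) ℂ) :
      (Matrix.vecMulVec (actOnFirst V ψ) (star (actOnFirst V ψ))).trace = 1 := by
    rw [Matrix.trace_vecMulVec, dotProduct_comm, star_actOnFirst_dotProduct_self hV, hψ]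
  have hherm : H.IsHermitian := by
    rw [hH, Matrix.IsHermitian]
    simp [Matrix.conjTranspose_sum, Matrix.conjTranspose_smul, Matrix.conjTranspose_vecMulVec]
  have htr : H.trace = 0 := by
    rw [hH, Matrix.trace_sum]
    refine Finset.sum_eq_zero fun x _ => ?_
    rw [Matrix.trace_smul, Matrix.trace_sub, htrv U hU, htrv _ (hUs x), sub_self, smul_zero]
  have hval (P : Matrix (Fin d × Fin k) (Fin d × Fin k) ℂ) : (P * H).trace.re
      = ∑ x, p x * advantage U Us ((actionMatrix ψ)ᴴ * P * actionMatrix ψ) x := by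
    have hv (a : Fin d × Fin k → ℂ) :
        (P * Matrix.vecMulVec a (star a)).trace = star a ⬝ᵥ (P *ᵥ a) := by
      rw [Matrix.mul_vecMulVec, Matrix.trace_vecMulVec, dotProduct_comm]
    rw [hH, Finset.mul_sum, Matrix.trace_sum, Complex.re_sum]
    refine Finset.sum_congr rfl fun x _ => ?_
    rw [Matrix.mul_smul, Matrix.trace_smul, mul_sub, Matrix.trace_sub, hv, hv, smul_eq_mul,
      Complex.re_ofReal_mul, Complex.sub_re, advantage, sesqForm_actionMatrix,
      sesqForm_actionMatrix]
  have h := isGreatest_traceDist hherm htr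
  simpa only [hval] using h

theorem sum_mul_advantage_le_one {Q : Matrix (Fin d × Fin d) (Fin d × Fin d) ℂ}
    (hQ : Q ∈ acceptanceForms d) (hU : U ∈ Matrix.unitaryGroup (Fin d) ℂ)
    (hp : p ∈ stdSimplex ℝ X) : ∑ x, p x * advantage U Us Q x ≤ 1 := by
  rw [← hp.2]
  refine Finset.sum_le_sum fun x _ => mul_le_of_le_one_right (hp.1 x) ?_
  have h1 := hQ.2 U hU
  have h2 := re_sesqForm_self_nonneg (Us x) hQ.1
  rw [advantage]
  linarith

theorem sum_mul_advantage_le_diamondDist (hU : U ∈ Matrix.unitaryGroup (Fin d) ℂ)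
    (hUs : ∀ x, Us x ∈ Matrix.unitaryGroup (Fin d) ℂ) (hp : p ∈ stdSimplex ℝ X)
    {Q : Matrix (Fin d × Fin d) (Fin d × Fin d) ℂ} (hQ : Q ∈ testForms d) :
    ∑ x, p x * advantage U Us Q x
      ≤ diamondDist (conjBy U) (mixture (fun x => conjBy (Us x)) p) := by
  obtain ⟨k, ψ, P, hψ, hP, rfl⟩ := hQ
  refine ((isGreatest_traceDist_ampliate_mixture hU hUs hp hψ).2 ⟨P, hP, rfl⟩).trans ?_
  refine le_csSup ⟨1, ?_⟩ ⟨k, _, mem_pureStates_iff.mpr ⟨ψ, hψ, rfl⟩, rfl⟩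
  rintro _ ⟨l, Φ, hΦ, rfl⟩
  obtain ⟨φ, hφ, rfl⟩ := mem_pureStates_iff.mp hΦ
  obtain ⟨R, hR, h⟩ := (isGreatest_traceDist_ampliate_mixture hU hUs hp hφ).1
  rw [← h]
  exact sum_mul_advantage_le_one
    (testForms_subset_acceptanceForms d ⟨l, φ, R, hφ, hR, rfl⟩) hU hp

theorem exists_lt_sum_mul_advantage (hd : d ≠ 0) (hU : U ∈ Matrix.unitaryGroup (Fin d) ℂ)
    (hUs : ∀ x, Us x ∈ Matrix.unitaryGroup (Fin d) ℂ) (hp : p ∈ stdSimplex ℝ X) {c : ℝ}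
    (hc : c < diamondDist (conjBy U) (mixture (fun x => conjBy (Us x)) p)) :
    ∃ Q ∈ testForms d, c < ∑ x, p x * advantage U Us Q x := by
  have : Nonempty (Fin d) := ⟨⟨0, Nat.pos_of_ne_zero hd⟩⟩
  let i : Fin d := Classical.arbitrary _
  rw [diamondDist] at hc
  obtain ⟨_, ⟨k, Φ, hΦ, rfl⟩, h⟩ := exists_lt_of_lt_csSup
    (by exact ⟨_, 1, _, mem_pureStates_iff.mpr ⟨Pi.single (i, 0) 1, by simp, rfl⟩, rfl⟩) hc
  obtain ⟨ψ, hψ, rfl⟩ := mem_pureStates_iff.mp hΦ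
  obtain ⟨P, hP, hPe⟩ := (isGreatest_traceDist_ampliate_mixture hU hUs hp hψ).1
  exact ⟨_, ⟨k, ψ, P, hψ, hP, rfl⟩, by rwa [← hPe] at h⟩

theorem exists_isLeast_diamondDist_mixture [Nonempty X] (hd : d ≠ 0)
    (hU : U ∈ Matrix.unitaryGroup (Fin d) ℂ)
    (hUs : ∀ x, Us x ∈ Matrix.unitaryGroup (Fin d) ℂ) :
    ∃ p ∈ stdSimplex ℝ X, IsLeast ((fun p => diamondDist (conjBy U)
      (mixture (fun x => conjBy (Us x)) p)) '' stdSimplex ℝ X)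
      (diamondDist (conjBy U) (mixture (fun x => conjBy (Us x)) p)) := by
  classical
  have hlsc : LowerSemicontinuousOn (fun p => diamondDist (conjBy U)
      (mixture (fun x => conjBy (Us x)) p)) (stdSimplex ℝ X) := by
    intro p hp c hc
    obtain ⟨Q, hQ, hlt⟩ := exists_lt_sum_mul_advantage hd hU hUs hp hc
    have hcont : Continuous fun p : X → ℝ => ∑ x, p x * advantage U Us Q x := by fun_prop
    filter_upwards [self_mem_nhdsWithin,
      mem_nhdsWithin_of_mem_nhds (hcont.continuousAt.eventually (lt_mem_nhds hlt))] with q hq hq2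
    exact hq2.trans_le (sum_mul_advantage_le_diamondDist hU hUs hq hQ)
  obtain ⟨p, hp, hmin⟩ := hlsc.exists_isMinOn
    ⟨_, single_mem_stdSimplex ℝ (Classical.arbitrary X)⟩ (isCompact_stdSimplex ℝ X)
  exact ⟨p, hp, ⟨p, hp, rfl⟩, by rintro _ ⟨q, hq, rfl⟩; exact hmin hq⟩

/-- The lower bound comes from testing a maximally entangled input for the output expected from
`U`. -/
theorem one_sub_sq_le_diamondDist_mixture (hd : d ≠ 0)
    (hU : U ∈ Matrix.unitaryGroup (Fin d) ℂ)
    (hUs : ∀ x, Us x ∈ Matrix.unitaryGroup (Fin d) ℂ) (hp : p ∈ stdSimplex ℝ X) {b : ℝ}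
    (hb : ∀ x, ‖(Uᴴ * Us x).trace‖ / d ≤ b) :
    1 - b ^ 2 ≤ diamondDist (conjBy U) (mixture (fun x => conjBy (Us x)) p) := by
  have hd0 : (d : ℂ) ≠ 0 := by exact_mod_cast hd
  obtain ⟨ψ, hψ, hr⟩ := exists_reducedState_eq (d := d)
    (ρ := (d : ℂ)⁻¹ • (1 : Matrix (Fin d) (Fin d) ℂ))
    ⟨Matrix.PosSemidef.one.smul (by simp), by simp [hd0]⟩
  set a := actOnFirst U ψ with ha
  have haa : star a ⬝ᵥ a = 1 := by rw [ha, star_actOnFirst_dotProduct_self hU, hψ]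
  have hP : Matrix.vecMulVec a (star a) ∈ Set.Icc 0 1 := by
    refine ⟨(Matrix.posSemidef_vecMulVec_self_star a).nonneg, ?_⟩
    rw [Matrix.le_iff]
    set A := Matrix.vecMulVec a (star a) with hA
    have hAA : A * A = A := by
      rw [hA, Matrix.vecMulVec_mul_vecMulVec, haa, one_smul]
    have hAh : Aᴴ = A := by simp [hA, Matrix.conjTranspose_vecMulVec]
    have : 1 - A = (1 - A)ᴴ * (1 - A) := by
      rw [Matrix.conjTranspose_sub, Matrix.conjTranspose_one, hAh, mul_sub, sub_mul, sub_mul, hAA]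
      simp
    rw [this]
    exact Matrix.posSemidef_conjTranspose_mul_self _
  have hform (W : Matrix (Fin d) (Fin d) ℂ) :
      (sesqForm ((actionMatrix ψ)ᴴ * Matrix.vecMulVec a (star a) * actionMatrix ψ) W W).re
        = ‖star a ⬝ᵥ actOnFirst W ψ‖ ^ 2 := by
    rw [sesqForm_actionMatrix, Matrix.vecMulVec_mulVec, dotProduct_smul,
      Matrix.star_dotProduct (actOnFirst W ψ)]
    rw [op_smul_eq_mul, Complex.star_def, Complex.conj_mul', ← Complex.ofReal_pow, Complex.ofReal_re]
  refine le_trans ?_ (sum_mul_advantage_le_diamondDist hU hUs hp ⟨d, ψ, _, hψ, hP, rfl⟩)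
  calc 1 - b ^ 2 = ∑ x, p x * (1 - b ^ 2) := by rw [← Finset.sum_mul, hp.2, one_mul]
    _ ≤ _ := Finset.sum_le_sum fun x _ => mul_le_mul_of_nonneg_left ?_ (hp.1 x)
  have hx : ‖star a ⬝ᵥ actOnFirst (Us x) ψ‖ = ‖(Uᴴ * Us x).trace‖ / d := by
    rw [ha, star_actOnFirst_dotProduct, hr, Matrix.mul_smul, mul_one, Matrix.trace_smul, smul_eq_mul,
      norm_mul, norm_inv, Complex.norm_natCast]
    ring
  rw [advantage, hform, hform, haa, hx, norm_one, one_pow]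
  have := pow_le_pow_left₀ (by positivity) (hb x) 2
  linarith

/-- If every unitary `V` has overlap `|tr (V† Us x ρ)|² ≥ 1 - c` with a suitable `Us x`, uniformly in
the state `ρ`, then some mixture is within `c` of any given unitary transformation. The existence of
the mixture follows from a bound on a single advantage for each acceptance form `Q`, obtained at an
`x` chosen for the maximizer `V` of `Q` instead of `U`. -/
theorem exists_diamondDist_mixture_le [Nonempty X] (hd : d ≠ 0)
    (hU : U ∈ Matrix.unitaryGroup (Fin d) ℂ)
    (hUs : ∀ x, Us x ∈ Matrix.unitaryGroup (Fin d) ℂ) {c : ℝ} (hc0 : 0 ≤ c)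
    (hc : ∀ V ∈ Matrix.unitaryGroup (Fin d) ℂ, ∃ x, ∀ ρ ∈ densityMatrices d,
      1 - c ≤ ‖(Vᴴ * Us x * ρ).trace‖ ^ 2) :
    ∃ p ∈ stdSimplex ℝ X, diamondDist (conjBy U) (mixture (fun x => conjBy (Us x)) p) ≤ c := by
  have hlin : IsLinearMap ℝ (advantage U Us) := by
    constructor
    · intro Q R; ext x; simp [advantage, sesqForm, Matrix.add_mulVec]; ring
    · intro r Q; ext x; simp [advantage, sesqForm, Matrix.smul_mulVec]; ring
  obtain ⟨p, hp, h⟩ := exists_mem_stdSimplex_forall_sum_le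
    (S := advantage U Us '' acceptanceForms d) (c := c)
    ((convex_acceptanceForms d).is_linear_image hlin) (by
      rintro _ ⟨Q, hQ, rfl⟩
      obtain ⟨V, hV, hmax⟩ := (isCompact_unitaryGroup d).exists_isMaxOn ⟨U, hU⟩
        (continuous_re_sesqForm (Q := Q)).continuousOn
      have hUV : (sesqForm Q U U).re ≤ (sesqForm Q V V).re := hmax hU
      obtain ⟨x, hx⟩ := hc V hV
      refine ⟨x, ?_⟩
      have hx0 := re_sesqForm_self_nonneg (Us x) hQ.1
      rw [advantage]
      rcases (re_sesqForm_self_nonneg V hQ.1).eq_or_lt with h0 | hpos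
      · linarith
      obtain ⟨ρ, hρ, hρeq⟩ := exists_densityMatrix_of_isMax hQ.1 hV (fun W hW => hmax hW) hpos
      have hVV : V * (Vᴴ * Us x) = Us x := by
        rw [← mul_assoc, ← Matrix.star_eq_conjTranspose, Matrix.mem_unitaryGroup_iff.mp hV, one_mul]
      have heq := hρeq (Vᴴ * Us x)
      rw [hVV] at heq
      have hcs := norm_sq_sesqForm_le V (Us x) hQ.1
      rw [heq, norm_mul, Complex.norm_real, Real.norm_of_nonneg hpos.le, mul_pow, sq, mul_assoc]
        at hcs
      have h1 := le_of_mul_le_mul_left hcs hpos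
      have h2 := mul_le_mul_of_nonneg_left (hx ρ hρ) hpos.le
      have h3 := mul_le_mul_of_nonneg_right (hQ.2 V hV) hc0
      linarith)
  refine ⟨p, hp, le_of_forall_lt fun b hb => ?_⟩
  obtain ⟨Q, hQ, hlt⟩ := exists_lt_sum_mul_advantage hd hU hUs hp hb
  exact hlt.trans_le (h _ ⟨Q, testForms_subset_acceptanceForms d hQ, rfl⟩)

end mixture

/-! ### Trace bound, minima and maxima of distances -/

/-- In terms of `δ = 1 - √(1 - ε²)` the bound reads `|tr (U† V)| / d ≤ 1 - 2 δ / d`. -/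
theorem norm_trace_conjTranspose_mul_div_le {d : ℕ} (hd : d ≠ 0)
    {U V : Matrix (Fin d) (Fin d) ℂ} (hU : U ∈ Matrix.unitaryGroup (Fin d) ℂ)
    (hV : V ∈ Matrix.unitaryGroup (Fin d) ℂ) {ε : ℝ} (hε : 0 ≤ ε)
    (h : ε ≤ diamondDist (conjBy U) (conjBy V)) :
    ‖(Uᴴ * V).trace‖ / d ≤ 1 - 2 * (1 - √(1 - ε ^ 2)) / d := by
  have hd0 : (0 : ℝ) < d := by exact_mod_cast Nat.pos_of_ne_zero hd
  have hW : Uᴴ * V ∈ Matrix.unitaryGroup (Fin d) ℂ := mul_mem (Unitary.star_mem hU) hV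
  suffices hs : (‖(Uᴴ * V).trace‖ - (d - 2)) / 2 ≤ √(1 - ε ^ 2) by
    rw [div_le_iff₀ hd0, sub_mul, div_mul_cancel₀ _ hd0.ne']
    linarith
  set q := (‖(Uᴴ * V).trace‖ - (d - 2)) / 2 with hq
  rcases le_or_gt q 0 with hq0 | hq0
  · exact hq0.trans (Real.sqrt_nonneg _)
  refine Real.le_sqrt_of_sq_le ?_
  have hle : diamondDist (conjBy U) (conjBy V) ≤ √(1 - q ^ 2) := by
    rw [diamondDist_conjBy hU hV]
    refine Real.sSup_le ?_ (Real.sqrt_nonneg _)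
    rintro _ ⟨ρ, hρ, rfl⟩
    refine Real.sqrt_le_sqrt (sub_le_sub_left ?_ 1)
    refine pow_le_pow_left₀ hq0.le ?_ 2
    linarith [norm_trace_le_of_densityMatrix hW hρ]
  have h1 := h.trans hle
  rcases le_or_gt 0 (1 - q ^ 2) with hq1 | hq1
  · have := (Real.le_sqrt hε hq1).mp h1
    linarith
  · have hq2 : ‖(Uᴴ * V).trace‖ ≤ d := by
      calc ‖(Uᴴ * V).trace‖ ≤ ∑ i, ‖(Uᴴ * V) i i‖ := norm_sum_le _ _
        _ ≤ ∑ _i : Fin d, (1 : ℝ) :=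
          Finset.sum_le_sum fun i _ => entry_norm_bound_of_unitary hW i i
        _ = d := by simp
    nlinarith

theorem diamondDist_nonneg {d : ℕ} {U V : Matrix (Fin d) (Fin d) ℂ}
    (hU : U ∈ Matrix.unitaryGroup (Fin d) ℂ) (hV : V ∈ Matrix.unitaryGroup (Fin d) ℂ) :
    0 ≤ diamondDist (conjBy U) (conjBy V) := by
  rw [diamondDist_conjBy hU hV]
  refine Real.sSup_nonneg ?_
  rintro _ ⟨ρ, -, rfl⟩
  exact Real.sqrt_nonneg _

theorem diamondDist_le_one {d : ℕ} {U V : Matrix (Fin d) (Fin d) ℂ}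
    (hU : U ∈ Matrix.unitaryGroup (Fin d) ℂ) (hV : V ∈ Matrix.unitaryGroup (Fin d) ℂ) :
    diamondDist (conjBy U) (conjBy V) ≤ 1 := by
  rw [diamondDist_conjBy hU hV]
  refine Real.sSup_le ?_ zero_le_one
  rintro _ ⟨ρ, -, rfl⟩
  exact Real.sqrt_le_one.mpr (by linarith [sq_nonneg ‖(Uᴴ * V * ρ).trace‖])

theorem exists_isLeast_range {X : Type*} [Fintype X] [Nonempty X] (f : X → ℝ) :
    ∃ x, IsLeast (Set.range f) (f x) := by
  obtain ⟨x, hx⟩ := Finite.exists_min f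
  exact ⟨x, ⟨x, rfl⟩, by rintro _ ⟨y, rfl⟩; exact hx y⟩

theorem exists_isGreatest_isLeast_diamondDist {d : ℕ} {X : Type*} [Fintype X] [Nonempty X]
    {Us : X → Matrix (Fin d) (Fin d) ℂ} (hUs : ∀ x, Us x ∈ Matrix.unitaryGroup (Fin d) ℂ) :
    ∃ ε, IsGreatest {e : ℝ | ∃ Υ ∈ unitaryTransformations d,
      IsLeast (Set.range fun x => diamondDist Υ (conjBy (Us x))) e} ε := by
  -- The minimum over `x` is written as `Finset.inf'` to see that it is continuous.
  have hcont := ContinuousOn.finset_inf'_apply (s := Finset.univ) Finset.univ_nonempty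
    fun x _ => continuousOn_diamondDist (hUs x)
  have hleast (Υ : SuperOp d) {e : ℝ}
      (he : IsLeast (Set.range fun x => diamondDist Υ (conjBy (Us x))) e) :
      e = Finset.univ.inf' Finset.univ_nonempty fun x => diamondDist Υ (conjBy (Us x)) := by
    obtain ⟨x, hx⟩ := he.1
    refine le_antisymm (Finset.le_inf' _ _ fun y _ => he.2 ⟨y, rfl⟩) ?_
    rw [← hx]
    exact Finset.inf'_le (fun x => diamondDist Υ (conjBy (Us x))) (Finset.mem_univ x)
  obtain ⟨V, hV, hmax⟩ := (isCompact_unitaryGroup d).exists_isMaxOn ⟨1, one_mem _⟩ hcont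
  obtain ⟨x, hx⟩ := exists_isLeast_range fun x => diamondDist (conjBy V) (conjBy (Us x))
  refine ⟨_, ⟨_, ⟨V, hV, rfl⟩, hx⟩, ?_⟩
  rintro e ⟨_, ⟨W, hW, rfl⟩, he⟩
  rw [hleast _ he, hleast _ hx]
  exact hmax hW

end

theorem theorem1 (d : ℕ) (hd : 2 ≤ d) {X : Type*} [Fintype X] [Nonempty X]
    (Υ : SuperOp d) (hΥ : Υ ∈ unitaryTransformations d)
    (Υs : X → SuperOp d) (hΥs : ∀ x, Υs x ∈ unitaryTransformations d) :
    ∃ εΥ δΥ ε err : ℝ,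
      IsLeast (Set.range fun x => diamondDist Υ (Υs x)) εΥ ∧
      δΥ = 1 - √(1 - εΥ ^ 2) ∧
      IsGreatest {e : ℝ | ∃ Υ' ∈ unitaryTransformations d,
        IsLeast (Set.range fun x => diamondDist Υ' (Υs x)) e} ε ∧
      IsLeast ((fun p => diamondDist Υ (mixture Υs p)) '' stdSimplex ℝ X) err ∧
      2 / d * εΥ ^ 2 ≤ 4 * δΥ / d * (1 - δΥ / d) ∧
      4 * δΥ / d * (1 - δΥ / d) ≤ err ∧
      err ≤ ε ^ 2 := by
  have hd0 : d ≠ 0 := by omega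
  have hd2 : (2 : ℝ) ≤ d := by exact_mod_cast hd
  obtain ⟨U, hU, rfl⟩ := hΥ
  choose Us hUs hΥs using hΥs
  obtain rfl : Υs = fun x => conjBy (Us x) := funext hΥs
  obtain ⟨y, hy⟩ := exists_isLeast_range fun x => diamondDist (conjBy U) (conjBy (Us x))
  obtain ⟨ε, hε⟩ := exists_isGreatest_isLeast_diamondDist hUs
  obtain ⟨p, hp, herr⟩ := exists_isLeast_diamondDist_mixture hd0 hU hUs
  set e := diamondDist (conjBy U) (conjBy (Us y)) with he
  have he0 : 0 ≤ e := diamondDist_nonneg hU (hUs y)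
  have he1 : e ≤ 1 := diamondDist_le_one hU (hUs y)
  set δ := 1 - √(1 - e ^ 2) with hδ
  refine ⟨e, δ, ε, _, hy, rfl, hε, herr, ?_, ?_, ?_⟩
  · have hsq : √(1 - e ^ 2) ^ 2 = 1 - e ^ 2 := Real.sq_sqrt (by nlinarith)
    have hee : e ^ 2 = 2 * δ - δ ^ 2 := by
      rw [show √(1 - e ^ 2) = 1 - δ by rw [hδ]; ring] at hsq
      linarith
    have : 4 * δ / d * (1 - δ / d) - 2 / d * e ^ 2 = 2 * δ ^ 2 * (d - 2) / d ^ 2 := by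
      rw [hee]; field_simp; ring
    have h2 : 0 ≤ 2 * δ ^ 2 * (d - 2) / d ^ 2 :=
      div_nonneg (mul_nonneg (by positivity) (by linarith)) (by positivity)
    linarith
  · have h := one_sub_sq_le_diamondDist_mixture hd0 hU hUs hp fun x =>
      norm_trace_conjTranspose_mul_div_le hd0 hU (hUs x) he0 (hy.2 ⟨x, rfl⟩)
    refine le_trans (le_of_eq ?_) h
    rw [hδ]; ring
  · obtain ⟨q, hq, hle⟩ := exists_diamondDist_mixture_le hd0 hU hUs (sq_nonneg ε) fun V hV => by
      obtain ⟨x, hx⟩ := exists_isLeast_range fun x => diamondDist (conjBy V) (conjBy (Us x))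
      refine ⟨x, fun ρ hρ => ?_⟩
      have h1 := (sqrt_le_diamondDist hV (hUs x) hρ).trans (hε.2 ⟨_, ⟨V, hV, rfl⟩, hx⟩)
      have h2 := (Real.sqrt_le_iff.mp h1).2
      linarith
    exact (herr.2 ⟨q, hq, rfl⟩).trans hle
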